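/- Permutations are of finite length and written in one-line notation. A permutation $\pi$ contains $\sigma$ if some subsequence of $\pi$ is order isomorphic to $\sigma$; a permutation class is a set of permutations closed downward under containment, and the basis of a class $\mathcal{C}$ is the unique antichain $B$ (with respect to containment) such that $\mathcal{C}$ is the set of all permutations containing no element of $B$. For a permutation $\sigma$ of length $m$ and nonempty permutations $\alpha_1,\dots,\alpha_m$, the inflation $\sigma[\alpha_1,\dots,\alpha_m]$ is the permutation obtained by replacing each entry $\sigma(i)$ by an interval (a block of contiguous positions with contiguous values) order isomorphic to $\alpha_i$. A class $\mathcal{C}$ is wreath-closed if $\sigma[\alpha_1,\dots,\alpha_m]\in\mathcal{C}$ for all $\sigma\in\mathcal{C}$ and all nonempty $\alpha_1,\dots,\alpha_m\in\mathcal{C}$, and the wreath closure $\mathcal{W}(X)$ of a set $X$ of permutations is the smallest wreath-closed class containing $X$. A permutation is sum indecomposable if it is not of the form $12[\pi,\rho]$ with $\pi,\rho$ nonempty. An increasing oscillation is a sum indecomposable permutation that is order isomorphic to a subsequence of the infinite sequence $4,1,6,3,8,5,\dots,2k+2,2k-1,\dots$; a decreasing oscillation is the reverse of an increasing oscillation;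 an oscillation is a permutation of either kind. Let $\mathcal{O}$ be the class of all permutations contained in some oscillation. **Proposition.** The basis of $\mathcal{W}(\mathcal{O})$ consists exactly of the permutations $$25314,\ 41352,\ 246153,\ 251364,\ 314625,\ 351624,\ 415263$$ and all of their images under the eight symmetries generated by reverse, complement and inverse. -/

import Mathlib

/-- A permutation of finite length: a length `n` together with a bijection of `Fin n`
(positions and values are numbered from `0`). -/
abbrev FinPerm : Type := Σ n : ℕ, Equiv.Perm (Fin n)

namespace FinPerm

/-- One-line notation, with the usual values `1, …, n`. -/
def oneLine (π : FinPerm) : List ℕ := List.ofFn fun i => (π.2 i : ℕ) + 1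

/-- `Contained σ π`: some subsequence of `π` is order isomorphic to `σ`. -/
def Contained (σ π : FinPerm) : Prop :=
  ∃ f : Fin σ.1 → Fin π.1, StrictMono f ∧
    ∀ i j, σ.2 i < σ.2 j ↔ π.2 (f i) < π.2 (f j)

/-- Permutation classes: sets of permutations closed downward under containment. -/
def IsPermClass (C : Set FinPerm) : Prop :=
  ∀ π ∈ C, ∀ σ, Contained σ π → σ ∈ C

/-- The closure of a set of permutations: everything contained in one of its members. -/
def closure (X : Set FinPerm) : Set FinPerm :=
  {σ | ∃ π ∈ X, Contained σ π}

/-- The permutations that contain no member of `B`. -/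
def Av (B : Set FinPerm) : Set FinPerm :=
  {π | ∀ β ∈ B, ¬ Contained β π}

/-- `B` is the basis of `C`: an antichain with `C = Av(B)`. -/
def IsBasis (B C : Set FinPerm) : Prop :=
  IsAntichain Contained B ∧ C = Av B

/-- `τ = σ[α₁, …, αₘ]`. The bijection `e` sends the `a`-th entry of `αᵢ` to its position in `τ`:
the `i`-th block of positions is order isomorphic to `αᵢ`, and the blocks are ordered
among themselves, by position and by value, as the entries of `σ` are. -/
def IsInflation (σ : FinPerm) (α : Fin σ.1 → FinPerm) (τ : FinPerm) : Prop :=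
  ∃ e : (Σ i : Fin σ.1, Fin (α i).1) ≃ Fin τ.1,
    (∀ i a b, a < b → e ⟨i, a⟩ < e ⟨i, b⟩) ∧
    (∀ i j a b, i < j → e ⟨i, a⟩ < e ⟨j, b⟩) ∧
    (∀ i a b, (α i).2 a < (α i).2 b → τ.2 (e ⟨i, a⟩) < τ.2 (e ⟨i, b⟩)) ∧
    (∀ i j a b, σ.2 i < σ.2 j → τ.2 (e ⟨i, a⟩) < τ.2 (e ⟨j, b⟩))

/-- A wreath-closed permutation class: it contains every inflation of a member by
nonempty members. -/
def IsWreathClosed (C : Set FinPerm) : Prop :=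
  IsPermClass C ∧
    ∀ (σ : FinPerm) (α : Fin σ.1 → FinPerm) (τ : FinPerm),
      σ ∈ C → (∀ i, α i ∈ C) → (∀ i, 0 < (α i).1) → IsInflation σ α τ → τ ∈ C

/-- The wreath closure: the smallest wreath-closed class that contains `X`. -/
def wreathClosure (X : Set FinPerm) : Set FinPerm :=
  {π | ∀ C, IsWreathClosed C → X ⊆ C → π ∈ C}

/-- `τ = π ⊕ ρ = 12[π, ρ]`. -/
def IsDirectSum (π ρ τ : FinPerm) : Prop :=
  IsInflation ⟨2, Equiv.refl (Fin 2)⟩ ![π, ρ] τ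

/-- Not a direct sum of two nonempty (hence shorter) permutations. -/
def SumIndecomposable (τ : FinPerm) : Prop :=
  ∀ π ρ : FinPerm, 0 < π.1 → 0 < ρ.1 → ¬ IsDirectSum π ρ τ

/-- The reverse of `π`: its one-line notation read backwards. -/
def reverse (π : FinPerm) : FinPerm := ⟨π.1, Fin.revPerm.trans π.2⟩

/-- The complement of `π`: each value `v` becomes `n + 1 - v` (values from `1` to `n`). -/
def complement (π : FinPerm) : FinPerm := ⟨π.1, π.2.trans Fin.revPerm⟩

/-- The inverse permutation. -/
def inverse (π : FinPerm) : FinPerm := ⟨π.1, π.2.symm⟩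

/-- The images of `π` under the eight symmetries generated by reverse, complement and inverse. -/
def symmetries (π : FinPerm) : Set FinPerm :=
  {π, reverse π, complement π, reverse (complement π),
    inverse π, reverse (inverse π), complement (inverse π), reverse (complement (inverse π))}

/-- The increasing oscillating sequence `4, 1, 6, 3, 8, 5, …`, indexed from `0`. -/
def oscSeq (k : ℕ) : ℕ := if Even k then k + 4 else k

/-- Increasing oscillations: the sum indecomposable permutations contained in the increasing
oscillating sequence. -/
def IsIncreasingOscillation (π : FinPerm) : Prop :=
  SumIndecomposable π ∧
    ∃ f : Fin π.1 → ℕ, StrictMono f ∧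
      ∀ i j, π.2 i < π.2 j ↔ oscSeq (f i) < oscSeq (f j)

/-- Decreasing oscillations: the reverses of the increasing ones. -/
def IsDecreasingOscillation (π : FinPerm) : Prop :=
  ∃ ρ, IsIncreasingOscillation ρ ∧ π = reverse ρ

def IsOscillation (π : FinPerm) : Prop :=
  IsIncreasingOscillation π ∨ IsDecreasingOscillation π

/-- The class `O`: the closure of the set of all oscillations. -/
def oscillationClass : Set FinPerm := closure {π | IsOscillation π}

end FinPerm

/-!
The basis `basisPerms` consists of twenty simple permutations, two of length five and eighteen of
length six. Two inclusions show that `Av basisPerms` is the wreath closure of the oscillations.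

A class that avoids simple permutations is wreath-closed (`isWreathClosed_Av`), and each basis
permutation contains one of 321, 2341, 4123, 3412, none of which occurs in the increasing
oscillating sequence (`oscillationClass_subset_Av`). So the wreath closure is contained in
`Av basisPerms`.

Conversely, a permutation that is not simple is an inflation of a shorter permutation by shorter
permutations (`exists_isInflation_of_not_isSimple`), so by induction it remains to show that every
simple `π` in `Av basisPerms` is an oscillation. This is a statement about the inversion graph of
`π`, which is prime because `π` is simple (`IsSimple.prime`) and therefore has an induced path with
four vertices (`IsSimple.exists_path_four`). The main point is `isTwin_of_distinguishes`: over an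
induced path `v 0, v 1, v 2, v 3`, a vertex that distinguishes two twins of `v i` is itself a twin
of `v i`, since every other configuration of these six points contains a basis permutation or is
not realized by any permutation. Hence the twins of `v i` form a module, and by primality `v i` has no other twin (`IsTwin.eq`). What is
left for a further vertex, again by excluding configurations of at most six points, is to be
adjacent to all or none of the path, to extend it at an end, or to form a house with it. A house
becomes an induced path with five vertices in the reversal, and from five vertices on houses are
excluded too, so that an induced path can be extended until it contains all entries
(`IsPath.extend`). Long induced cycles do not arise, because both orders of `π` agree on
non-adjacent vertices and run along the path (`IsPath.order`). The same ordering embeds a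
permutation whose inversion graph is a path into the oscillating sequence
(`IsPath.exists_embedding`).

The finitely many configurations are excluded by the kernel evaluating `refuted`, which lists the
possible left-to-right orders of labelled points with prescribed inversions and looks for a basis
word in each of the resulting patterns.
-/

namespace FinPerm

/-! ### Containment and patterns -/

theorem Contained.refl (π : FinPerm) : Contained π π := ⟨id, strictMono_id, fun _ _ => Iff.rfl⟩

theorem Contained.trans {ρ σ τ : FinPerm} (h₁ : Contained ρ σ) (h₂ : Contained σ τ) :
    Contained ρ τ := by
  obtain ⟨f, hf, hf'⟩ := h₁
  obtain ⟨g, hg, hg'⟩ := h₂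
  exact ⟨g ∘ f, hg.comp hf, fun i j => (hf' i j).trans (hg' _ _)⟩

theorem Contained.length_le {σ τ : FinPerm} (h : Contained σ τ) : σ.1 ≤ τ.1 := by
  obtain ⟨f, hf, -⟩ := h
  simpa using Fintype.card_le_of_injective f hf.injective

theorem strictMono_self_eq_id {n : ℕ} {f : Fin n → Fin n} (hf : StrictMono f) : f = id :=
  (StrictMono.range_inj hf strictMono_id).1 (by
    rw [Set.range_id, Set.range_eq_univ]
    exact Finite.surjective_of_injective hf.injective)

theorem perm_eq_of_lt_iff {n : ℕ} {σ τ : Equiv.Perm (Fin n)}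
    (h : ∀ i j, σ i < σ j ↔ τ i < τ j) : σ = τ := by
  have hm : StrictMono (τ ∘ σ.symm) := fun i j hij => by
    simpa using (h (σ.symm i) (σ.symm j)).1 (by simpa using hij)
  have : (τ ∘ σ.symm) = id := strictMono_self_eq_id hm
  ext i
  simpa using (congrArg Fin.val (congrFun this (σ i))).symm

theorem Contained.eq_of_length_eq {σ τ : FinPerm} (h : Contained σ τ) (hl : σ.1 = τ.1) :
    σ = τ := by
  obtain ⟨n, σ⟩ := σ
  obtain ⟨m, τ⟩ := τ
  obtain rfl : n = m := hl
  obtain ⟨f, hf, hf'⟩ := h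
  have hid : f = id := strictMono_self_eq_id hf
  subst hid
  exact congrArg (Sigma.mk n) (perm_eq_of_lt_iff hf')

theorem Contained.antisymm {σ τ : FinPerm} (h₁ : Contained σ τ) (h₂ : Contained τ σ) : σ = τ :=
  h₁.eq_of_length_eq (le_antisymm h₁.length_le h₂.length_le)

/-- A class has at most one basis. -/
theorem IsBasis.unique {B B' C : Set FinPerm} (h : IsBasis B C) (h' : IsBasis B' C) : B = B' := by
  have key : ∀ {B B' : Set FinPerm}, IsBasis B C → IsBasis B' C → B ⊆ B' := by
    intro B B' h h' β hβ
    have h₁ : β ∉ Av B' := by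
      rw [← h'.2, h.2]
      exact fun hA => hA β hβ (Contained.refl β)
    simp only [Av, Set.mem_ofPred_eq, not_forall, not_not] at h₁
    obtain ⟨β', hβ', hc⟩ := h₁
    have h₂ : β' ∉ Av B := by
      rw [← h.2, h'.2]
      exact fun hA => hA β' hβ' (Contained.refl β')
    simp only [Av, Set.mem_ofPred_eq, not_forall, not_not] at h₂
    obtain ⟨β'', hβ'', hc'⟩ := h₂
    have : β'' = β := by
      by_contra hne
      exact h.1 hβ'' hβ hne (hc'.trans hc)
    subst this
    rwa [hc'.antisymm hc]
  exact (key h h').antisymm (key h' h)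

/-- Any selection of entries of a permutation has a pattern. -/
theorem exists_pattern {n k : ℕ} (π : Equiv.Perm (Fin n)) (f : Fin k → Fin n)
    (hf : Function.Injective f) :
    ∃ τ : Equiv.Perm (Fin k), ∀ i j, τ i < τ j ↔ π (f i) < π (f j) := by
  have hm : StrictMono ((fun i => π (f i)) ∘ Tuple.sort fun i => π (f i)) :=
    (Tuple.monotone_sort fun i => π (f i)).strictMono_of_injective
      ((π.injective.comp hf).comp (Tuple.sort _).injective)
  refine ⟨(Tuple.sort fun i => π (f i)).symm, fun i j => ?_⟩
  rw [← hm.lt_iff_lt]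
  simp

/-- A value of a permutation is the number of smaller values. -/
theorem perm_val_eq_card {k : ℕ} (τ : Equiv.Perm (Fin k)) (i : Fin k) :
    (τ i : ℕ) = (Finset.univ.filter fun j => τ j < τ i).card := by
  have : (Finset.univ.filter fun j => τ j < τ i) = (Finset.Iio (τ i)).map τ.symm.toEmbedding := by
    ext j
    simp only [Finset.mem_filter, Finset.mem_univ, true_and, Finset.mem_map, Finset.mem_Iio,
      Equiv.coe_toEmbedding]
    exact ⟨fun h => ⟨τ j, h, by simp⟩, by rintro ⟨a, ha, rfl⟩; simpa using ha⟩
  rw [this, Finset.card_map, Fin.card_Iio]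

theorem length_oneLine (π : FinPerm) : (oneLine π).length = π.1 := by simp [oneLine]

theorem getElem_oneLine (π : FinPerm) (i : ℕ) (h : i < (oneLine π).length) :
    (oneLine π)[i] = (π.2 ⟨i, by simpa [oneLine] using h⟩ : ℕ) + 1 := by
  simp [oneLine]

/-- The word of the pattern formed by the entries of `π` at the positions in `l`. -/
def patternWord {n : ℕ} (π : Equiv.Perm (Fin n)) (l : List (Fin n)) : List ℕ :=
  l.map fun a => l.countP (fun b => decide (π b < π a)) + 1

theorem exists_contained_of_sorted {n : ℕ} (π : Equiv.Perm (Fin n)) (l : List (Fin n))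
    (hl : l.Pairwise (· < ·)) :
    ∃ τ : FinPerm, oneLine τ = patternWord π l ∧ Contained τ ⟨n, π⟩ := by
  have hmono : StrictMono l.get := fun i j hij => List.pairwise_iff_get.1 hl i j hij
  obtain ⟨τ, hτ⟩ := exists_pattern π l.get hmono.injective
  refine ⟨⟨l.length, τ⟩, ?_, l.get, hmono, hτ⟩
  apply List.ext_getElem
  · simp [oneLine, patternWord]
  · intro i h₁ h₂
    have hi : i < l.length := by simpa [oneLine] using h₁
    rw [getElem_oneLine]
    simp only [patternWord, List.getElem_map, add_left_inj]
    rw [perm_val_eq_card]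
    have : l.countP (fun b => decide (π b < π l[i])) =
        (List.finRange l.length).countP fun j => decide (τ j < τ ⟨i, hi⟩) := by
      generalize hc : l[i] = c
      conv_lhs => rw [← List.map_get_finRange l]
      rw [List.countP_map]
      congr 1
      ext j
      simp [hτ, ← hc]
    rw [this, List.countP_eq_length_filter]
    rw [← List.toFinset_card_of_nodup ((List.nodup_finRange _).filter _)]
    congr 1
    ext j
    simp

/-! ### Symmetries -/

theorem reverse_reverse (π : FinPerm) : reverse (reverse π) = π := by
  obtain ⟨n, σ⟩ := π
  simp only [reverse]
  congr 1
  ext i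
  simp

theorem complement_complement (π : FinPerm) : complement (complement π) = π := by
  obtain ⟨n, σ⟩ := π
  simp only [complement]
  congr 1
  ext i
  simp

theorem inverse_inverse (π : FinPerm) : inverse (inverse π) = π := rfl

theorem Contained.reverse {σ π : FinPerm} (h : Contained σ π) :
    Contained (reverse σ) (reverse π) := by
  obtain ⟨f, hf, hf'⟩ := h
  refine ⟨fun i => Fin.rev (f (Fin.rev i)), fun i j hij => ?_, fun i j => ?_⟩
  · exact Fin.rev_lt_rev.2 (hf (Fin.rev_lt_rev.2 hij))
  · change σ.2 (Fin.rev i) < σ.2 (Fin.rev j) ↔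
      π.2 (Fin.rev (Fin.rev (f (Fin.rev i)))) < π.2 (Fin.rev (Fin.rev (f (Fin.rev j))))
    rw [Fin.rev_rev, Fin.rev_rev]
    exact hf' _ _

/-- The complement, on words. -/
def wordCompl (l : List ℕ) : List ℕ := l.map fun v => l.length + 1 - v

/-- The inverse, on words. -/
def wordInv (l : List ℕ) : List ℕ := (List.range l.length).map fun v => l.idxOf (v + 1) + 1

theorem oneLine_reverse (π : FinPerm) : oneLine (reverse π) = (oneLine π).reverse := by
  apply List.ext_getElem
  · simp [oneLine, reverse]
  · intro i h₁ h₂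
    have hi : i < π.1 := by simpa [oneLine, reverse] using h₁
    rw [getElem_oneLine, List.getElem_reverse, getElem_oneLine]
    change (π.2 (Fin.rev ⟨i, hi⟩) : ℕ) + 1 = _
    congr 3
    simp only [Fin.ext_iff, Fin.val_rev, length_oneLine]
    omega

theorem oneLine_complement (π : FinPerm) : oneLine (complement π) = wordCompl (oneLine π) := by
  apply List.ext_getElem
  · simp [oneLine, complement, wordCompl]
  · intro i h₁ h₂
    have hi : i < π.1 := by simpa [oneLine, complement] using h₁
    simp only [wordCompl, List.getElem_map]
    rw [getElem_oneLine, getElem_oneLine]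
    have hl := length_oneLine π
    have hr : ((complement π).2 ⟨i, hi⟩ : ℕ) = π.1 - (π.2 ⟨i, hi⟩ + 1) := Fin.val_rev _
    have := (π.2 ⟨i, hi⟩).2
    omega

theorem oneLine_nodup (π : FinPerm) : (oneLine π).Nodup := by
  rw [oneLine, List.nodup_ofFn]
  intro i j h
  simpa [Fin.val_inj] using h

theorem oneLine_inverse (π : FinPerm) : oneLine (inverse π) = wordInv (oneLine π) := by
  apply List.ext_getElem
  · simp [oneLine, inverse, wordInv]
  · intro i h₁ h₂
    have hi : i < π.1 := by simpa [oneLine, inverse] using h₁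
    simp only [wordInv, List.getElem_map, List.getElem_range]
    rw [getElem_oneLine]
    have hlt : (π.2.symm ⟨i, hi⟩ : ℕ) < (oneLine π).length := by simp [oneLine]
    have : (oneLine π)[(π.2.symm ⟨i, hi⟩ : ℕ)] = i + 1 := by
      rw [getElem_oneLine]; simp
    rw [← this, (oneLine_nodup π).idxOf_getElem]
    rfl

/-! ### The words of the basis -/

/-- The one-line notations of the symmetric images of the seven permutations. -/
def basisWords : List (List ℕ) :=
  [[2, 5, 3, 1, 4], [4, 1, 3, 5, 2], [2, 4, 6, 1, 3, 5], [2, 4, 6, 1, 5, 3], [2, 5, 1, 3, 6, 4],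
    [3, 1, 4, 6, 2, 5], [3, 5, 1, 6, 2, 4], [3, 5, 1, 6, 4, 2], [3, 5, 2, 6, 1, 4],
    [3, 6, 1, 5, 2, 4], [3, 6, 2, 5, 1, 4], [4, 1, 5, 2, 6, 3], [4, 1, 6, 2, 5, 3],
    [4, 2, 5, 1, 6, 3], [4, 2, 6, 1, 3, 5], [4, 2, 6, 1, 5, 3], [4, 6, 3, 1, 5, 2],
    [5, 2, 6, 4, 1, 3], [5, 3, 1, 6, 2, 4], [5, 3, 1, 6, 4, 2]]

/-- The permutations whose words are listed in `basisWords`. -/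
def basisPerms : Set FinPerm := {π | oneLine π ∈ basisWords}

/-- The seven words whose symmetric images make up `basisWords`. -/
def generatorWords : List (List ℕ) :=
  [[2, 5, 3, 1, 4], [4, 1, 3, 5, 2], [2, 4, 6, 1, 5, 3], [2, 5, 1, 3, 6, 4],
    [3, 1, 4, 6, 2, 5], [3, 5, 1, 6, 2, 4], [4, 1, 5, 2, 6, 3]]

theorem basisWords_closed : ∀ l ∈ basisWords,
    l.reverse ∈ basisWords ∧ wordCompl l ∈ basisWords ∧ wordInv l ∈ basisWords := by
  decide +kernel

theorem generatorWords_subset : ∀ l ∈ generatorWords, l ∈ basisWords := by decide +kernel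

theorem basisWords_generated : ∀ l ∈ basisWords,
    l ∈ generatorWords ∨ l.reverse ∈ generatorWords ∨ wordCompl l ∈ generatorWords ∨
    wordCompl l.reverse ∈ generatorWords ∨ wordInv l ∈ generatorWords ∨
    wordInv l.reverse ∈ generatorWords ∨ wordInv (wordCompl l) ∈ generatorWords ∨
    wordInv (wordCompl l.reverse) ∈ generatorWords := by
  decide +kernel

theorem reverse_mem_basisPerms {π : FinPerm} (h : π ∈ basisPerms) : reverse π ∈ basisPerms := by
  rw [basisPerms, Set.mem_ofPred_eq, oneLine_reverse]
  exact (basisWords_closed _ h).1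

theorem complement_mem_basisPerms {π : FinPerm} (h : π ∈ basisPerms) :
    complement π ∈ basisPerms := by
  rw [basisPerms, Set.mem_ofPred_eq, oneLine_complement]
  exact (basisWords_closed _ h).2.1

theorem inverse_mem_basisPerms {π : FinPerm} (h : π ∈ basisPerms) : inverse π ∈ basisPerms := by
  rw [basisPerms, Set.mem_ofPred_eq, oneLine_inverse]
  exact (basisWords_closed _ h).2.2

theorem basisPerms_eq :
    {π : FinPerm | ∃ β : FinPerm,
        FinPerm.oneLine β ∈
          ({[2, 5, 3, 1, 4], [4, 1, 3, 5, 2], [2, 4, 6, 1, 5, 3], [2, 5, 1, 3, 6, 4],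
            [3, 1, 4, 6, 2, 5], [3, 5, 1, 6, 2, 4], [4, 1, 5, 2, 6, 3]} : Set (List ℕ)) ∧
        π ∈ FinPerm.symmetries β} = basisPerms := by
  have hgen : ∀ l : List ℕ, l ∈ ({[2, 5, 3, 1, 4], [4, 1, 3, 5, 2], [2, 4, 6, 1, 5, 3],
      [2, 5, 1, 3, 6, 4], [3, 1, 4, 6, 2, 5], [3, 5, 1, 6, 2, 4], [4, 1, 5, 2, 6, 3]} :
      Set (List ℕ)) ↔ l ∈ generatorWords := by
    intro l
    simp [generatorWords]
  ext π
  simp only [hgen, Set.mem_ofPred_eq]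
  constructor
  · rintro ⟨β, hβ, hπ⟩
    have hb : β ∈ basisPerms := generatorWords_subset _ hβ
    have hi := inverse_mem_basisPerms hb
    simp only [symmetries, Set.mem_insert_iff, Set.mem_singleton_iff] at hπ
    rcases hπ with rfl | rfl | rfl | rfl | rfl | rfl | rfl | rfl
    · exact hb
    · exact reverse_mem_basisPerms hb
    · exact complement_mem_basisPerms hb
    · exact reverse_mem_basisPerms (complement_mem_basisPerms hb)
    · exact hi
    · exact reverse_mem_basisPerms hi
    · exact complement_mem_basisPerms hi
    · exact reverse_mem_basisPerms (complement_mem_basisPerms hi)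
  · intro hπ
    have h := basisWords_generated _ hπ
    simp only [← oneLine_reverse, ← oneLine_complement, ← oneLine_inverse] at h
    rcases h with h | h | h | h | h | h | h | h <;> refine ⟨_, h, ?_⟩ <;>
      simp [symmetries, reverse_reverse, complement_complement, inverse_inverse]

/-! ### Intervals, simplicity and the inversion graph -/

section InversionGraph

variable {n : ℕ} {π : Equiv.Perm (Fin n)}

/-- Adjacency in the inversion graph: the entries at positions `i` and `j` are inverted. -/
def Inverted (π : Equiv.Perm (Fin n)) (i j : Fin n) : Prop :=
  (i < j ∧ π j < π i) ∨ (j < i ∧ π i < π j)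

/-- The entry at `i` lies to the left of and below the entry at `j`. -/
def Below (π : Equiv.Perm (Fin n)) (i j : Fin n) : Prop := i < j ∧ π i < π j

/-- A set of positions whose entries form an interval: convex both by position and by value. -/
def IsIntvl (π : Equiv.Perm (Fin n)) (S : Set (Fin n)) : Prop :=
  ∀ a ∈ S, ∀ b ∈ S, ∀ c, (a < c → c < b → c ∈ S) ∧ (π a < π c → π c < π b → c ∈ S)

/-- Simple permutations: only the trivial sets are intervals. With this convention every
permutation of length at most two is simple. -/
def IsSimple (π : Equiv.Perm (Fin n)) : Prop :=
  ∀ S, IsIntvl π S → S.Subsingleton ∨ S = Set.univ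

/-- A module of the inversion graph: no outside vertex distinguishes two of its elements. -/
def IsModule (π : Equiv.Perm (Fin n)) (M : Set (Fin n)) : Prop :=
  ∀ x ∉ M, ∀ a ∈ M, ∀ b ∈ M, Inverted π x a → Inverted π x b

theorem Inverted.symm {i j : Fin n} (h : Inverted π i j) : Inverted π j i := Or.symm h

theorem inverted_comm {i j : Fin n} : Inverted π i j ↔ Inverted π j i := Or.comm

theorem Inverted.ne {i j : Fin n} (h : Inverted π i j) : i ≠ j := by
  rintro rfl
  rcases h with h | h <;> exact lt_irrefl _ h.1

theorem Below.trans {i j k : Fin n} (h₁ : Below π i j) (h₂ : Below π j k) : Below π i k :=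
  ⟨h₁.1.trans h₂.1, h₁.2.trans h₂.2⟩

theorem Below.not_inverted {i j : Fin n} (h : Below π i j) : ¬ Inverted π i j := by
  rintro (h' | h')
  · exact lt_asymm h.2 h'.2
  · exact lt_asymm h.1 h'.1

theorem below_or_below {i j : Fin n} (hne : i ≠ j) (h : ¬ Inverted π i j) :
    Below π i j ∨ Below π j i := by
  have hne' : π i ≠ π j := fun h' => hne (π.injective h')
  simp only [Inverted, Below] at *
  rcases lt_or_gt_of_ne hne with h₁ | h₁ <;> rcases lt_or_gt_of_ne hne' with h₂ | h₂ <;> tauto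

theorem inverted_trans_revPerm {i j : Fin n} :
    Inverted (π.trans Fin.revPerm) i j ↔ i ≠ j ∧ ¬ Inverted π i j := by
  have h' : i ≠ j → π i ≠ π j := fun hne h' => hne (π.injective h')
  simp only [Inverted, Equiv.trans_apply, Fin.revPerm_apply, Fin.rev_lt_rev]
  grind

theorem IsSimple.trans_revPerm (h : IsSimple π) : IsSimple (π.trans Fin.revPerm) := by
  intro S hS
  refine h S fun a ha b hb c => ⟨(hS a ha b hb c).1, fun h₁ h₂ => ?_⟩
  have := (hS b hb a ha c).2
  simp only [Equiv.trans_apply, Fin.revPerm_apply, Fin.rev_lt_rev] at this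
  exact this h₂ h₁

theorem IsModule.trans_revPerm {M : Set (Fin n)} (h : IsModule π M) :
    IsModule (π.trans Fin.revPerm) M := by
  intro x hx a ha b hb
  simp only [inverted_trans_revPerm]
  exact fun h' => ⟨fun hxb => hx (hxb ▸ hb), fun hxb => h'.2 (h x hx b hb a ha hxb)⟩

/-- The inductive step of `IsSimple.prime`: an outside entry `c` that is above one element of a
module and below another, in both orders, splits the module into two smaller modules. If both
are single entries, then all entries between them form an interval. -/
theorem IsSimple.prime_aux (hπ : IsSimple π) {M : Set (Fin n)} (hM : IsModule π M)
    (ih : ∀ N : Set (Fin n), N.ncard < M.ncard → IsModule π N → N.Subsingleton ∨ N = Set.univ)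
    {a b c : Fin n} (ha : a ∈ M) (hb : b ∈ M) (hc : c ∉ M) (hac : Below π a c)
    (hcb : Below π c b) : False := by
  have hnot : ∀ m ∈ M, Below π m c ∨ Below π c m := by
    intro m hm
    refine below_or_below (fun h => hc (h ▸ hm)) fun h => ?_
    exact hac.not_inverted (hM c hc m hm a ha h.symm).symm
  have hlow : ∀ m ∈ M, Below π m c → m = a := by
    have := ih {m | m ∈ M ∧ Below π m c} (Set.ncard_lt_ncard ⟨fun m hm => hm.1, fun h =>
        lt_asymm (h hb).2.1 hcb.1⟩) ?_
    · rcases this with h | h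
      · exact fun m hm hmc => h ⟨hm, hmc⟩ ⟨ha, hac⟩
      · have : c ∈ {m | m ∈ M ∧ Below π m c} := h ▸ Set.mem_univ c
        exact (hc this.1).elim
    · intro x hx y hy z hz hxy
      by_cases hxM : x ∈ M
      · rcases hnot x hxM with h | h
        · exact (hx ⟨hxM, h⟩).elim
        · exact ((hy.2.trans h).not_inverted hxy.symm).elim
      · exact hM x hxM y hy.1 z hz.1 hxy
  have hhigh : ∀ m ∈ M, Below π c m → m = b := by
    have := ih {m | m ∈ M ∧ Below π c m} (Set.ncard_lt_ncard ⟨fun m hm => hm.1, fun h =>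
        lt_asymm (h ha).2.1 hac.1⟩) ?_
    · rcases this with h | h
      · exact fun m hm hmc => h ⟨hm, hmc⟩ ⟨hb, hcb⟩
      · have : c ∈ {m | m ∈ M ∧ Below π c m} := h ▸ Set.mem_univ c
        exact (hc this.1).elim
    · intro x hx y hy z hz hxy
      by_cases hxM : x ∈ M
      · rcases hnot x hxM with h | h
        · exact ((h.trans hy.2).not_inverted hxy).elim
        · exact (hx ⟨hxM, h⟩).elim
      · exact hM x hxM y hy.1 z hz.1 hxy
  have hab := hac.trans hcb
  have hMab : ∀ z, z ∉ M → (Inverted π z a ↔ Inverted π z b) := fun z hz =>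
    ⟨hM z hz a ha b hb, hM z hz b hb a ha⟩
  have hmem : ∀ m ∈ M, m = a ∨ m = b := fun m hm =>
    (hnot m hm).imp (hlow m hm) (hhigh m hm)
  have hbetween : ∀ z, (a < z ∧ z < b) ∨ (π a < π z ∧ π z < π b) → Below π a z ∧ Below π z b := by
    intro z hz
    have hza : z ≠ a := by
      rintro rfl
      rcases hz with h | h <;> exact lt_irrefl _ h.1
    have hzb : z ≠ b := by
      rintro rfl
      rcases hz with h | h <;> exact lt_irrefl _ h.2
    have hzM : z ∉ M := fun h => (hmem z h).elim hza hzb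
    have h₁ := hMab z hzM
    have hza' : π z ≠ π a := fun h => hza (π.injective h)
    have hzb' : π z ≠ π b := fun h => hzb (π.injective h)
    simp only [Inverted, Below] at *
    grind
  have huniv : ∀ z, z = a ∨ z = b ∨ (Below π a z ∧ Below π z b) := by
    have hI : IsIntvl π {z | z = a ∨ z = b ∨ (Below π a z ∧ Below π z b)} := by
      have hpos : ∀ z ∈ {z | z = a ∨ z = b ∨ (Below π a z ∧ Below π z b)},
          a ≤ z ∧ z ≤ b ∧ π a ≤ π z ∧ π z ≤ π b := by
        rintro z (rfl | rfl | ⟨h, h'⟩)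
        · exact ⟨le_rfl, hab.1.le, le_rfl, hab.2.le⟩
        · exact ⟨hab.1.le, le_rfl, hab.2.le, le_rfl⟩
        · exact ⟨h.1.le, h'.1.le, h.2.le, h'.2.le⟩
      intro x hx y hy z
      obtain ⟨hx₁, hx₂, hx₃, hx₄⟩ := hpos x hx
      obtain ⟨hy₁, hy₂, hy₃, hy₄⟩ := hpos y hy
      exact ⟨fun h₁ h₂ => Or.inr (Or.inr (hbetween z (Or.inl
          ⟨hx₁.trans_lt h₁, h₂.trans_le hy₂⟩))),
        fun h₁ h₂ => Or.inr (Or.inr (hbetween z (Or.inr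
          ⟨hx₃.trans_lt h₁, h₂.trans_le hy₄⟩)))⟩
    rcases hπ _ hI with h | h
    · exact (hab.1.ne (h (Or.inl rfl) (Or.inr (Or.inl rfl)))).elim
    · intro z
      have : z ∈ {z | z = a ∨ z = b ∨ (Below π a z ∧ Below π z b)} := h ▸ Set.mem_univ z
      exact this
  have hmin : ∀ z, a ≤ z ∧ π a ≤ π z := by
    intro z
    rcases huniv z with rfl | rfl | ⟨h, -⟩
    · exact ⟨le_rfl, le_rfl⟩
    · exact ⟨hab.1.le, hab.2.le⟩
    · exact ⟨h.1.le, h.2.le⟩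
  have hI : IsIntvl π {z | z ≠ a} := by
    intro x hx y hy z
    refine ⟨fun h₁ _ => ?_, fun h₁ _ => ?_⟩ <;> rintro rfl
    · exact absurd h₁ (not_lt.2 (hmin x).1)
    · exact absurd h₁ (not_lt.2 (hmin x).2)
  rcases hπ _ hI with h | h
  · exact hcb.1.ne (h hac.1.ne' hab.1.ne')
  · have : a ∈ {z | z ≠ a} := h ▸ Set.mem_univ a
    exact this rfl

/-- The inversion graph of a simple permutation is prime: its modules are trivial. -/
theorem IsSimple.prime (hπ : IsSimple π) {M : Set (Fin n)} (hM : IsModule π M) :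
    M.Subsingleton ∨ M = Set.univ := by
  induction hk : M.ncard using Nat.strong_induction_on generalizing π M with
  | _ k ih =>
    subst hk
    refine hπ M fun a ha b hb c => ?_
    have ih₁ : ∀ N : Set (Fin n), N.ncard < M.ncard → IsModule π N →
        N.Subsingleton ∨ N = Set.univ := fun N hN hNM => ih _ hN hπ hNM rfl
    have ih₂ : ∀ N : Set (Fin n), N.ncard < M.ncard → IsModule (π.trans Fin.revPerm) N →
        N.Subsingleton ∨ N = Set.univ := fun N hN hNM => ih _ hN hπ.trans_revPerm hNM rfl
    have key := @IsSimple.prime_aux n π hπ M hM ih₁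
    have key' := @IsSimple.prime_aux n _ hπ.trans_revPerm M hM.trans_revPerm ih₂
    simp only [Below, Equiv.trans_apply, Fin.revPerm_apply, Fin.rev_lt_rev] at key'
    have hcab : c ∉ M → (Inverted π c a ↔ Inverted π c b) := fun hc =>
      ⟨hM c hc a ha b hb, hM c hc b hb a ha⟩
    -- If `c` is inverted with all of `M`, it lies between `a` and `b` in the complement of `π`.
    have h₁ := fun hc => @key a b c ha hb hc
    have h₂ := fun hc => @key' a b c ha hb hc
    have h₄ := fun hc => @key' b a c hb ha hc
    simp only [Below] at h₁
    clear key key' ih ih₁ ih₂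
    have hπa : c ≠ a → π c ≠ π a := fun h h' => h (π.injective h')
    have hπb : c ≠ b → π c ≠ π b := fun h h' => h (π.injective h')
    simp only [Inverted] at hcab
    by_cases hc : c ∈ M
    · exact ⟨fun _ _ => hc, fun _ _ => hc⟩
    · have hca : c ≠ a := fun h => hc (h ▸ ha)
      have hcb : c ≠ b := fun h => hc (h ▸ hb)
      replace hπa := hπa hca
      replace hπb := hπb hcb
      replace h₁ := h₁ hc
      replace h₂ := h₂ hc
      replace h₄ := h₄ hc
      replace hcab := hcab hc
      constructor <;> intro h h' <;> exfalso <;> grind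

/-! ### Induced paths -/

/-- `v 0, …, v (k - 1)` is an induced path of the inversion graph. -/
def IsPath (π : Equiv.Perm (Fin n)) (k : ℕ) (v : ℕ → Fin n) : Prop :=
  ∀ i j, i < j → j < k → v i ≠ v j ∧ (Inverted π (v i) (v j) ↔ j = i + 1)

theorem isPath_four {a b c d : Fin n} (hac : a ≠ c) (had : a ≠ d) (hbd : b ≠ d)
    (h₁ : Inverted π a b) (h₂ : Inverted π b c) (h₃ : Inverted π c d) (h₄ : ¬ Inverted π a c)
    (h₅ : ¬ Inverted π a d) (h₆ : ¬ Inverted π b d) :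
    IsPath π 4 fun i => [a, b, c, d].getD i a := by
  intro i j hij hj
  have := h₁.ne
  have := h₂.ne
  have := h₃.ne
  interval_cases j <;> interval_cases i <;> simp_all

/-- The inversion graph of a simple permutation of length at least three has an induced path
with four vertices. Without one, the connected components of the complement of a neighbourhood
are modules, so that all neighbourhoods are cliques; then closed neighbourhoods are modules. -/
theorem IsSimple.exists_path_four (hπ : IsSimple π) (hn : 3 ≤ n) :
    ∃ v, IsPath π 4 v := by
  by_contra hno
  push Not at hno
  have hno' : ∀ a b c d : Fin n, a ≠ c → a ≠ d → b ≠ d → Inverted π a b → Inverted π b c →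
      Inverted π c d → ¬ Inverted π a c → ¬ Inverted π a d → Inverted π b d := by
    intro a b c d hac had hbd h₁ h₂ h₃ h₄ h₅
    by_contra h₆
    exact hno _ (isPath_four hac had hbd h₁ h₂ h₃ h₄ h₅ h₆)
  have hclique : ∀ x a b, Inverted π x a → Inverted π x b → a ≠ b → Inverted π a b := by
    intro x a b hxa hxb hab
    by_contra hnab
    let R : Fin n → Fin n → Prop := fun u w => Inverted π x w ∧ u ≠ w ∧ ¬ Inverted π u w
    have hsub : ∀ z, Relation.ReflTransGen R a z → Inverted π x z := by
      intro z hz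
      induction hz with
      | refl => exact hxa
      | tail _ h _ => exact h.1
    have huni : ∀ y, ¬ Relation.ReflTransGen R a y → ∀ z, Relation.ReflTransGen R a z →
        (Inverted π y a ↔ Inverted π y z) := by
      intro y hy z hz
      induction hz with
      | refl => exact Iff.rfl
      | @tail u w hu h ih =>
        rw [ih]
        have hxu := hsub u hu
        have hw := hu.tail h
        have hyu : y ≠ u := fun e => hy (e ▸ hu)
        have hyw : y ≠ w := fun e => hy (e ▸ hw)
        by_cases hxy : Inverted π x y
        · have h₁ : Inverted π u y := by
            by_contra hc
            exact hy (hu.tail ⟨hxy, hyu.symm, hc⟩)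
          have h₂ : Inverted π w y := by
            by_contra hc
            exact hy (hw.tail ⟨hxy, hyw.symm, hc⟩)
          exact ⟨fun _ => h₂.symm, fun _ => h₁.symm⟩
        · by_cases hyx : y = x
          · subst hyx
            exact ⟨fun _ => h.1, fun _ => hxu⟩
          · constructor
            · intro hc
              by_contra hc'
              exact h.2.2 (hno' y u x w hyx hyw h.2.1 hc hxu.symm h.1
                (fun e => hxy e.symm) hc')
            · intro hc
              by_contra hc'
              exact h.2.2 (hno' y w x u hyx hyu h.2.1.symm hc h.1.symm hxu
                (fun e => hxy e.symm) hc').symm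
    have hmod : IsModule π {z | Relation.ReflTransGen R a z} := by
      intro y hy u hu w hw h
      exact (huni y hy w hw).1 ((huni y hy u hu).2 h)
    rcases hπ.prime hmod with h | h
    · exact hab (h Relation.ReflTransGen.refl (Relation.ReflTransGen.single ⟨hxb, hab, hnab⟩))
    · have : x ∈ {z | Relation.ReflTransGen R a z} := h ▸ Set.mem_univ x
      exact (hsub x this).ne rfl
  have hclosed : ∀ x : Fin n, ∀ y, ¬ Inverted π x y := by
    intro x y hxy
    have hmod : IsModule π {z | z = x ∨ Inverted π x z} := by
      intro z hz u hu w hw h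
      exfalso
      apply hz
      rcases hu with rfl | hu
      · exact Or.inr h.symm
      · by_cases hzx : z = x
        · exact Or.inl hzx
        · exact Or.inr (hclique u x z hu.symm h.symm (Ne.symm hzx))
    rcases hπ.prime hmod with h | h
    · exact hxy.ne (h (Or.inl rfl) (Or.inr hxy))
    · have hall : ∀ z, z = x ∨ Inverted π x z := by
        intro z
        have : z ∈ {z | z = x ∨ Inverted π x z} := h ▸ Set.mem_univ z
        exact this
      have hmod' : IsModule π {z | z ≠ x} := by
        intro z hz u hu w hw h
        obtain rfl : z = x := by simpa using hz
        exact (hall w).resolve_left hw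
      rcases hπ.prime hmod' with h' | h'
      · have hcard : ({x, y}ᶜ : Finset (Fin n)).Nonempty := by
          rw [← Finset.card_pos, Finset.card_compl, Fintype.card_fin]
          have := Finset.card_le_two (a := x) (b := y)
          omega
        obtain ⟨z, hz⟩ := hcard
        simp only [Finset.mem_compl, Finset.mem_insert, Finset.mem_singleton, not_or] at hz
        exact hz.2 (h' hz.1 hxy.ne.symm)
      · have : x ∈ {z | z ≠ x} := h' ▸ Set.mem_univ x
        exact this rfl
  have hmod : IsModule π {z | z ≠ (⟨0, by omega⟩ : Fin n)} := fun x _ a _ b _ h =>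
    (hclosed _ _ h).elim
  rcases hπ.prime hmod with h | h
  · have := @h ⟨1, by omega⟩ (by simp) ⟨2, by omega⟩ (by simp)
    simp at this
  · have : (⟨0, by omega⟩ : Fin n) ∈ {z | z ≠ (⟨0, by omega⟩ : Fin n)} := h ▸ Set.mem_univ _
    exact this rfl

end InversionGraph

/-! ### Excluding labelled configurations by computation -/

/-- All ways to insert `x` into a list. -/
def inserts (x : ℕ) : List ℕ → List (List ℕ)
  | [] => [[x]]
  | b :: t => (x :: b :: t) :: (inserts x t).map (b :: ·)

/-- If a list is a left-to-right order of points whose inversions are given by `M`, then inversion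
and non-inversion are both transitive along the list. -/
def orderConsistent (M : ℕ → ℕ → Bool) : List ℕ → Bool
  | [] => true
  | a :: t => orderConsistent M t && consistentAt a t
where
  /-- The condition of `orderConsistent` for the triples that start with `a`. -/
  consistentAt (a : ℕ) : List ℕ → Bool
  | [] => true
  | b :: t => (t.all fun c => M a b != M b c || M a c == M a b) && consistentAt a t

/-- The possible left-to-right orders of labelled points whose inversions are given by `M`. -/
def orders (M : ℕ → ℕ → Bool) : List ℕ → List (List ℕ)
  | [] => [[]]
  | x :: xs => ((orders M xs).flatMap (inserts x)).filter (orderConsistent M)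

/-- The word of the pattern formed by labelled points, from their left-to-right order (the
second list, preceded by the reverse of the first) and their inversions. -/
def ranks (M : ℕ → ℕ → Bool) : List ℕ → List ℕ → List ℕ
  | _, [] => []
  | pre, a :: t =>
    (pre.countP (fun b => !M b a) + t.countP (fun b => M a b) + 1) :: ranks M (a :: pre) t

/-- The pattern formed by the listed points, or by all but one of them, is a basis word. -/
def containsBasisWord (M : ℕ → ℕ → Bool) (l : List ℕ) : Bool :=
  basisWords.contains (ranks M [] l) ||
    (List.range l.length).any fun i => basisWords.contains (ranks M [] (l.eraseIdx i))

/-- No `m` points with inversions given by `M` occur in a permutation avoiding the basis. -/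
def refuted (M : ℕ → ℕ → Bool) (m : ℕ) : Bool :=
  (orders M (List.range m)).all (containsBasisWord M)

section Soundness

variable {n : ℕ} {π : Equiv.Perm (Fin n)} {p : ℕ → Fin n} {M : ℕ → ℕ → Bool}

/-- The points `p a`, for labels `a` in `s`, are distinct and have the inversions given by `M`. -/
def Realizes (π : Equiv.Perm (Fin n)) (p : ℕ → Fin n) (M : ℕ → ℕ → Bool) (s : List ℕ) : Prop :=
  ∀ a ∈ s, ∀ b ∈ s, a ≠ b → p a ≠ p b ∧ (M a b = true ↔ Inverted π (p a) (p b))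

theorem Realizes.subset {s t : List ℕ} (h : Realizes π p M s) (hts : t ⊆ s) :
    Realizes π p M t := fun a ha b hb => h a (hts ha) b (hts hb)

theorem perm_of_mem_inserts {x : ℕ} : ∀ {l l' : List ℕ}, l' ∈ inserts x l → l'.Perm (x :: l)
  | [], l', h => by simp_all [inserts]
  | b :: t, l', h => by
    simp only [inserts, List.mem_cons, List.mem_map] at h
    rcases h with rfl | ⟨l'', h, rfl⟩
    · exact List.Perm.refl _
    · exact ((perm_of_mem_inserts h).cons b).trans (List.Perm.swap x b t)

theorem exists_mem_inserts {x : ℕ} : ∀ {l : List ℕ}, (l.map p).Pairwise (· < ·) →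
    (∀ b ∈ l, p x ≠ p b) → ∃ l' ∈ inserts x l, (l'.map p).Pairwise (· < ·)
  | [], _, _ => ⟨[x], by simp [inserts], by simp⟩
  | b :: t, hl, hx => by
    rw [List.map_cons, List.pairwise_cons] at hl
    rcases lt_or_gt_of_ne (hx b (by simp)) with h | h
    · refine ⟨x :: b :: t, by simp [inserts], ?_⟩
      simp only [List.map_cons, List.pairwise_cons, List.mem_cons]
      refine ⟨?_, hl⟩
      rintro y (rfl | hy)
      · exact h
      · exact h.trans (hl.1 y hy)
    · obtain ⟨l', hl', hs⟩ := exists_mem_inserts hl.2 fun c hc => hx c (by simp [hc])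
      refine ⟨b :: l', by simp [inserts, hl'], ?_⟩
      rw [List.map_cons, List.pairwise_cons]
      refine ⟨fun y hy => ?_, hs⟩
      rw [((perm_of_mem_inserts hl').map p).mem_iff, List.map_cons, List.mem_cons] at hy
      rcases hy with rfl | hy
      · exact h
      · exact hl.1 y hy

theorem inverted_iff_of_lt {i j : Fin n} (h : i < j) : Inverted π i j ↔ π j < π i := by
  simp [Inverted, h, h.not_gt]

theorem not_inverted_iff_of_lt {i j : Fin n} (h : i < j) : ¬ Inverted π i j ↔ π i < π j := by
  rw [inverted_iff_of_lt h, not_lt, le_iff_lt_or_eq, or_iff_left]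
  exact fun h' => h.ne (π.injective h')

theorem Realizes.lt_of_sorted {s : List ℕ} {a : ℕ} {t : List ℕ} (h : Realizes π p M s)
    (hs : (a :: t) ⊆ s) (hl : ((a :: t).map p).Pairwise (· < ·)) {b : ℕ} (hb : b ∈ t) :
    p a < p b ∧ (M a b = true ↔ π (p b) < π (p a)) ∧ (M a b = false ↔ π (p a) < π (p b)) := by
  rw [List.map_cons, List.pairwise_cons] at hl
  have hab : p a < p b := hl.1 _ (List.mem_map_of_mem hb)
  have h' := (h a (hs (by simp)) b (hs (by simp [hb])) (fun e => hab.ne (e ▸ rfl))).2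
  exact ⟨hab, by rw [h', inverted_iff_of_lt hab],
    by rw [← Bool.not_eq_true, h', not_inverted_iff_of_lt hab]⟩

theorem Realizes.consistentAt {s : List ℕ} (h : Realizes π p M s) {a : ℕ} : ∀ {t : List ℕ},
    (a :: t) ⊆ s → ((a :: t).map p).Pairwise (· < ·) →
    orderConsistent.consistentAt M a t = true
  | [], _, _ => rfl
  | b :: t, hs, hl => by
    have hl' := hl
    rw [List.map_cons, List.pairwise_cons] at hl'
    simp only [orderConsistent.consistentAt, Bool.and_eq_true, List.all_eq_true]
    refine ⟨fun c hc => ?_, h.consistentAt (fun x hx => hs (by simp at hx ⊢; tauto)) ?_⟩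
    · have hab := (h.lt_of_sorted hs hl (b := b) (by simp)).2
      have hac := (h.lt_of_sorted hs hl (b := c) (by simp [hc])).2
      have hbc := (h.lt_of_sorted (fun x hx => hs (List.mem_cons_of_mem _ hx)) hl'.2 hc).2
      cases h₁ : M a b <;> cases h₂ : M b c <;> cases h₃ : M a c <;> simp_all
      · exact absurd (hab.2.trans hbc.2) hac.1.not_gt
      · exact absurd (hbc.1.trans hab.1) hac.2.not_gt
    · rw [List.map_cons, List.pairwise_cons]
      exact ⟨fun y hy => hl'.1 y (by simp at hy ⊢; tauto), (List.pairwise_cons.1 hl'.2).2⟩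

theorem Realizes.orderConsistent {s : List ℕ} (h : Realizes π p M s) : ∀ {l : List ℕ},
    l ⊆ s → (l.map p).Pairwise (· < ·) → orderConsistent M l = true
  | [], _, _ => rfl
  | a :: t, hs, hl => by
    simp only [FinPerm.orderConsistent, Bool.and_eq_true]
    refine ⟨h.orderConsistent (fun x hx => hs (List.mem_cons_of_mem _ hx)) ?_,
      h.consistentAt hs hl⟩
    exact (List.pairwise_cons.1 hl).2

theorem Realizes.exists_mem_orders : ∀ {s : List ℕ}, s.Nodup → Realizes π p M s →
    ∃ l ∈ orders M s, l.Perm s ∧ (l.map p).Pairwise (· < ·)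
  | [], _, _ => ⟨[], by simp [orders], List.Perm.refl _, by simp⟩
  | x :: xs, hs, h => by
    rw [List.nodup_cons] at hs
    obtain ⟨l, hl, hperm, hsort⟩ := (h.subset (List.subset_cons_self x xs)).exists_mem_orders hs.2
    obtain ⟨l', hl', hsort'⟩ := exists_mem_inserts (x := x) hsort fun b hb =>
      (h x (by simp) b (by simp [hperm.mem_iff.1 hb])
        (fun e => hs.1 (hperm.mem_iff.1 (e ▸ hb)))).1
    have hperm' : l'.Perm (x :: xs) := (perm_of_mem_inserts hl').trans (hperm.cons x)
    refine ⟨l', ?_, hperm', hsort'⟩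
    simp only [orders, List.mem_filter, List.mem_flatMap]
    exact ⟨⟨l, hl, hl'⟩, h.orderConsistent hperm'.subset hsort'⟩

theorem Realizes.ranks_eq {s : List ℕ} (h : Realizes π p M s) : ∀ {pre t : List ℕ},
    (pre.reverse ++ t) ⊆ s → ((pre.reverse ++ t).map p).Pairwise (· < ·) →
    ranks M pre t =
      t.map fun a => (pre.reverse ++ t).countP (fun b => decide (π (p b) < π (p a))) + 1
  | _, [], _, _ => rfl
  | pre, a :: t, hs, hl => by
    have ih := h.ranks_eq (pre := a :: pre) (t := t) (by simpa using hs) (by simpa using hl)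
    rw [ranks, ih]
    simp only [List.reverse_cons, List.append_assoc, List.singleton_append, List.map_cons,
      List.cons.injEq, add_left_inj, and_true]
    rw [List.countP_append, List.countP_reverse, List.countP_cons]
    simp only [lt_self_iff_false, decide_false, Bool.false_eq_true, if_false, add_zero]
    rw [List.map_append, List.pairwise_append] at hl
    congr 1
    · refine List.countP_congr fun b hb => ?_
      have hab : p b < p a := hl.2.2 _ (List.mem_map_of_mem (by simpa using hb)) _ (by simp)
      have h' := (h b (hs (by simp [hb])) a (hs (by simp)) (fun e => hab.ne (e ▸ rfl))).2
      rw [Bool.not_eq_true', decide_eq_true_eq, ← not_inverted_iff_of_lt hab, ← h',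
        Bool.not_eq_true]
    · refine List.countP_congr fun b hb => ?_
      have := (h.lt_of_sorted (fun x hx => hs (List.mem_append_right _ hx)) hl.2.1 hb).2.1
      rw [this, decide_eq_true_eq]

theorem Realizes.ranks_not_mem (hπ : (⟨n, π⟩ : FinPerm) ∈ Av basisPerms) {s : List ℕ}
    (h : Realizes π p M s) {l : List ℕ} (hls : l ⊆ s) (hl : (l.map p).Pairwise (· < ·)) :
    ranks M [] l ∉ basisWords := by
  obtain ⟨τ, hτ, hc⟩ := exists_contained_of_sorted π (l.map p) hl
  intro hmem
  refine hπ τ ?_ hc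
  rw [basisPerms, Set.mem_ofPred_eq, hτ]
  convert hmem
  rw [h.ranks_eq (pre := []) (by simpa using hls) (by simpa using hl)]
  simp only [patternWord, List.map_map, List.countP_map, List.reverse_nil, List.nil_append]
  rfl

theorem Realizes.refuted_eq_false (hπ : (⟨n, π⟩ : FinPerm) ∈ Av basisPerms) {m : ℕ}
    (h : Realizes π p M (List.range m)) : refuted M m = false := by
  obtain ⟨l, hl, hperm, hsort⟩ := h.exists_mem_orders List.nodup_range
  rw [← Bool.not_eq_true, refuted, List.all_eq_true]
  intro hall
  have := hall l hl
  simp only [containsBasisWord, Bool.or_eq_true, List.contains_iff_mem, List.any_eq_true] at this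
  rcases this with h' | ⟨i, -, h'⟩
  · exact h.ranks_not_mem hπ hperm.subset hsort h'
  · exact h.ranks_not_mem hπ (fun x hx => hperm.subset (List.eraseIdx_subset hx))
      (hsort.sublist ((List.eraseIdx_sublist l i).map p)) h'

end Soundness

/-- The symmetric matrix with given entries above the diagonal. -/
def symMatrix (f : ℕ → ℕ → Bool) (x y : ℕ) : Bool := if x < y then f x y else f y x

theorem realizes_symMatrix {n : ℕ} {π : Equiv.Perm (Fin n)} {p : ℕ → Fin n} {f : ℕ → ℕ → Bool}
    {m : ℕ} (h : ∀ x y, x < y → y < m → p x ≠ p y ∧ (f x y = true ↔ Inverted π (p x) (p y))) :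
    Realizes π p (symMatrix f) (List.range m) := by
  intro a ha b hb hab
  rw [List.mem_range] at ha hb
  rcases lt_or_gt_of_ne hab with hlt | hlt
  · simpa [symMatrix, hlt] using h a b hlt hb
  · have := h b a hlt ha
    rw [inverted_comm, ne_comm]
    simpa [symMatrix, hlt.not_gt] using this

/-- Entries for a path `0, …, k - 1` and a further vertex `k` with neighbours given by `b`. -/
def pathMatrix (k : ℕ) (b : ℕ → Bool) (x y : ℕ) : Bool :=
  if y < k then y == x + 1 else b x

/-- Entries for a path `0, 1, 2, 3`, a twin `4` of the vertex `i` (adjacent to it if `s`), and a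
vertex `5` not adjacent to `4` whose neighbours on the path are given by `b`. -/
def twinMatrix (i : ℕ) (s : Bool) (b : ℕ → Bool) (x y : ℕ) : Bool :=
  if y < 4 then y == x + 1
  else if y = 4 then (if x = i then s else x + 1 == i || i + 1 == x)
  else if x = 4 then false else b x

/-- If the vertex `5` is adjacent to the path vertex `i` but not to its twin `4`, then it is itself
a twin of `i` over the path. -/
theorem twinMatrix_refuted : ∀ (i : Fin 4) (s b₀ b₁ b₂ b₃ : Bool),
    [b₀, b₁, b₂, b₃].getD i false = true →
    refuted (symMatrix (twinMatrix i s fun x => [b₀, b₁, b₂, b₃].getD x false)) 6 = true ∨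
    ∀ x : ℕ, x < 4 → x ≠ i →
      [b₀, b₁, b₂, b₃].getD x false = (x + 1 == (i : ℕ) || (i : ℕ) + 1 == x) := by
  decide +kernel

/-- The possible neighbours of a further vertex on an induced path with four vertices: none, all,
those of a twin of a path vertex, those that extend the path, and those that form a house. -/
theorem pathMatrix_four_refuted : ∀ b₀ b₁ b₂ b₃ : Bool,
    refuted (symMatrix (pathMatrix 4 fun x => [b₀, b₁, b₂, b₃].getD x false)) 5 = true ∨
    (∃ i < 4, ∀ x < 4, x ≠ i → [b₀, b₁, b₂, b₃].getD x false = (x + 1 == i || i + 1 == x)) ∨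
    [b₀, b₁, b₂, b₃] ∈ [[false, false, false, false], [true, true, true, true],
      [true, false, false, false], [false, false, false, true],
      [true, true, false, true], [true, false, true, true]] := by
  decide +kernel

/-- The possible neighbours of a further vertex on an induced path with five vertices: none, all,
those of a twin over one of the two subpaths with four vertices, and those that extend the
path. -/
theorem pathMatrix_five_refuted : ∀ b₀ b₁ b₂ b₃ b₄ : Bool,
    refuted (symMatrix (pathMatrix 5 fun x => [b₀, b₁, b₂, b₃, b₄].getD x false)) 6 = true ∨
    (∃ s < 2, ∃ i < 4, ∀ x < 4, x ≠ i →
      [b₀, b₁, b₂, b₃, b₄].getD (x + s) false = (x + 1 == i || i + 1 == x)) ∨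
    [b₀, b₁, b₂, b₃, b₄] ∈ [[false, false, false, false, false], [true, true, true, true, true],
      [true, false, false, false, false], [false, false, false, false, true]] := by
  decide +kernel

/-! ### Induced paths in simple permutations that avoid the basis -/

section Paths

variable {n : ℕ} {π : Equiv.Perm (Fin n)} {v : ℕ → Fin n} {k : ℕ}

theorem IsPath.inj (h : IsPath π k v) {i j : ℕ} (hi : i < k) (hj : j < k) (hij : i ≠ j) :
    v i ≠ v j := by
  rcases lt_or_gt_of_ne hij with hlt | hlt
  · exact (h i j hlt hj).1
  · exact (h j i hlt hi).1.symm

theorem IsPath.inverted_iff (h : IsPath π k v) {i j : ℕ} (hi : i < k) (hj : j < k) :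
    Inverted π (v i) (v j) ↔ i + 1 = j ∨ j + 1 = i := by
  rcases lt_trichotomy i j with hlt | rfl | hlt
  · rw [(h i j hlt hj).2]
    omega
  · exact ⟨fun h => (h.ne rfl).elim, by omega⟩
  · rw [inverted_comm, (h j i hlt hi).2]
    omega

theorem IsPath.shift (h : IsPath π k v) {s m : ℕ} (hs : s + m ≤ k) :
    IsPath π m fun i => v (i + s) := by
  intro i j hij hj
  have := h (i + s) (j + s) (by omega) (by omega)
  exact ⟨this.1, this.2.trans (by omega)⟩

theorem IsPath.card_le (h : IsPath π k v) : k ≤ n := by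
  have hinj : Function.Injective fun i : Fin k => v i := by
    intro i j hij
    by_contra hne
    exact h.inj i.2 j.2 (fun e => hne (Fin.ext e)) hij
  simpa using Fintype.card_le_of_injective _ hinj

/-- `z` is a twin of the vertex `v i` over the other vertices of the path `v 0, v 1, v 2, v 3`. -/
def IsTwin (π : Equiv.Perm (Fin n)) (v : ℕ → Fin n) (i : ℕ) (z : Fin n) : Prop :=
  ∀ x < 4, x ≠ i → z ≠ v x ∧ (Inverted π z (v x) ↔ x + 1 = i ∨ i + 1 = x)

theorem IsPath.update_twin (h : IsPath π 4 v) {i : ℕ} {a : Fin n} (ha : IsTwin π v i a) :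
    IsPath π 4 (Function.update v i a) := by
  intro x y hxy hy
  by_cases hx' : x = i
  · subst hx'
    rw [Function.update_self, Function.update_of_ne hxy.ne']
    have := ha y hy hxy.ne'
    exact ⟨this.1, this.2.trans (by omega)⟩
  · rw [Function.update_of_ne hx']
    by_cases hy' : y = i
    · subst hy'
      rw [Function.update_self]
      have := ha x (by omega) hx'
      rw [ne_comm, inverted_comm]
      exact ⟨this.1, this.2.trans (by omega)⟩
    · rw [Function.update_of_ne hy']
      exact h x y hxy hy

theorem IsTwin.update {i : ℕ} {a z : Fin n} :
    IsTwin π (Function.update v i a) i z ↔ IsTwin π v i z := by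
  refine forall_congr' fun x => imp_congr_right fun _ => imp_congr_right fun hxi => ?_
  rw [Function.update_of_ne hxi]

theorem getD_four (f : ℕ → Bool) {x : ℕ} (hx : x < 4) :
    [f 0, f 1, f 2, f 3].getD x false = f x := by
  interval_cases x <;> rfl

theorem getD_five (f : ℕ → Bool) {x : ℕ} (hx : x < 5) :
    [f 0, f 1, f 2, f 3, f 4].getD x false = f x := by
  interval_cases x <;> rfl

open Classical in
/-- A vertex that distinguishes two twins of `v i` is itself a twin of `v i`. -/
theorem isTwin_of_distinguishes (hav : (⟨n, π⟩ : FinPerm) ∈ Av basisPerms) (hv : IsPath π 4 v)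
    {i : ℕ} (hi : i < 4) {a b q : Fin n} (ha : IsTwin π v i a) (hb : IsTwin π v i b)
    (hqa : Inverted π q a) (hqb : ¬ Inverted π q b) : IsTwin π v i q := by
  by_cases hqne : q = b
  · exact hqne ▸ hb
  have hqv : ∀ x < 4, x ≠ i → q ≠ v x := by
    rintro x hx hxi rfl
    exact hqb (((hb x hx hxi).2.2 ((ha x hx hxi).2.1 hqa.symm)).symm)
  have hab : a ≠ b := fun h => hqb (h ▸ hqa)
  have hw := hv.update_twin ha
  rw [← IsTwin.update (a := a)] at hb ⊢
  have hqw : ∀ x < 4, q ≠ Function.update v i a x := by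
    intro x hx
    by_cases hxi : x = i
    · subst hxi
      simpa using hqa.ne
    · simpa [hxi] using hqv x hx hxi
  have hwi : Function.update v i a i = a := Function.update_self ..
  generalize Function.update v i a = w at *
  subst hwi
  have hbit := fun x (hx : x < 4) => getD_four (fun x => decide (Inverted π q (w x))) hx
  have hreal : Realizes π (fun y => if y < 4 then w y else if y = 4 then b else q)
      (symMatrix (twinMatrix i (decide (Inverted π (w i) b))
        fun x => [decide (Inverted π q (w 0)), decide (Inverted π q (w 1)),
          decide (Inverted π q (w 2)), decide (Inverted π q (w 3))].getD x false))
      (List.range 6) := by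
    refine realizes_symMatrix fun x y hxy hy => ?_
    rcases (by omega : y < 4 ∨ y = 4 ∨ y = 5) with hy' | rfl | rfl
    · have hx' : x < 4 := by omega
      simpa [twinMatrix, hy', hx'] using
        (show w x ≠ w y ∧ (y = x + 1 ↔ _) from ⟨(hw x y hxy hy').1, (hw x y hxy hy').2.symm⟩)
    · simp only [twinMatrix, hxy, lt_irrefl, if_true, if_false]
      by_cases hxi : x = i
      · subst hxi
        simpa using hab
      · have := hb x hxy hxi
        rw [if_neg hxi, ne_comm, inverted_comm]
        simpa using ⟨this.1, this.2.symm⟩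
    · rcases (by omega : x = 4 ∨ x < 4) with rfl | hx'
      · simp only [twinMatrix]
        simpa using ⟨Ne.symm hqne, fun e : Inverted π b q => hqb e.symm⟩
      · have h4 : x ≠ 4 := by omega
        have := hqw x hx'
        simp only [twinMatrix, hx', h4, hbit x hx', if_true, if_false]
        rw [inverted_comm (i := w x)]
        simpa using this.symm
  have hf := hreal.refuted_eq_false hav
  have hi' : [decide (Inverted π q (w 0)), decide (Inverted π q (w 1)),
          decide (Inverted π q (w 2)), decide (Inverted π q (w 3))].getD i false = true := by
    rw [hbit i hi]
    simpa using hqa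
  rcases twinMatrix_refuted ⟨i, hi⟩ (decide (Inverted π (w i) b)) _ _ _ _ hi' with h | h
  · exact (Bool.false_ne_true (hf.symm.trans h)).elim
  · intro x hx hxi
    refine ⟨hqw x hx, ?_⟩
    have := h x hx hxi
    rw [hbit x hx, Bool.eq_iff_iff] at this
    simpa using this

/-- In a simple permutation that avoids the basis, the vertices of an induced path with four
vertices have no twins over the path, since their twins form a module. -/
theorem IsTwin.eq (hav : (⟨n, π⟩ : FinPerm) ∈ Av basisPerms) (hπ : IsSimple π)
    (hv : IsPath π 4 v) {i : ℕ} (hi : i < 4) {z : Fin n} (hz : IsTwin π v i z) : z = v i := by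
  have hself : IsTwin π v i (v i) := fun x hx hxi =>
    ⟨hv.inj hi hx (Ne.symm hxi), (hv.inverted_iff hi hx).trans (by omega)⟩
  have hmod : IsModule π {z | IsTwin π v i z} := by
    intro x hx a ha b hb hxa
    by_contra hxb
    exact hx (isTwin_of_distinguishes hav hv hi ha hb hxa hxb)
  rcases hπ.prime hmod with h | h
  · exact h hz hself
  · obtain ⟨x, hx, hxi⟩ : ∃ x < 4, x ≠ i := by
      by_cases h0 : i = 0
      · exact ⟨1, by omega, by omega⟩
      · exact ⟨0, by omega, Ne.symm h0⟩
    have : v x ∈ {z | IsTwin π v i z} := h ▸ Set.mem_univ _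
    exact ((this x hx hxi).1 rfl).elim

theorem IsPath.realizes (hv : IsPath π k v) {z : Fin n} (hz : ∀ x < k, z ≠ v x) {b : ℕ → Bool}
    (hb : ∀ x < k, b x = true ↔ Inverted π z (v x)) :
    Realizes π (fun y => if y < k then v y else z) (symMatrix (pathMatrix k b))
      (List.range (k + 1)) := by
  refine realizes_symMatrix fun x y hxy hy => ?_
  have hx : x < k := by omega
  by_cases hy' : y < k
  · simpa [pathMatrix, hx, hy'] using
      (show v x ≠ v y ∧ (y = x + 1 ↔ _) from ⟨(hv x y hxy hy').1, (hv x y hxy hy').2.symm⟩)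
  · simp only [pathMatrix, hx, hy', if_true, if_false]
    rw [hb x hx, inverted_comm]
    exact ⟨(hz x hx).symm, Iff.rfl⟩

open Classical in
/-- The neighbours of a further vertex on an induced path with four vertices: none, all, one end,
or three vertices that form a house with the path. -/
theorem IsPath.neighbours_four (hav : (⟨n, π⟩ : FinPerm) ∈ Av basisPerms) (hπ : IsSimple π)
    (hv : IsPath π 4 v) {z : Fin n} (hz : ∀ x < 4, z ≠ v x) :
    [decide (Inverted π z (v 0)), decide (Inverted π z (v 1)), decide (Inverted π z (v 2)),
      decide (Inverted π z (v 3))] ∈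
      [[false, false, false, false], [true, true, true, true], [true, false, false, false],
      [false, false, false, true], [true, true, false, true], [true, false, true, true]] := by
  have hbit := fun x (hx : x < 4) => getD_four (fun x => decide (Inverted π z (v x))) hx
  have hf := (hv.realizes hz (b := fun x => [decide (Inverted π z (v 0)),
    decide (Inverted π z (v 1)), decide (Inverted π z (v 2)),
      decide (Inverted π z (v 3))].getD x false)
    fun x hx => by rw [hbit x hx, decide_eq_true_eq]).refuted_eq_false hav
  rcases pathMatrix_four_refuted _ _ _ _ with h | ⟨i, hi, h⟩ | h
  · exact (Bool.false_ne_true (hf.symm.trans h)).elim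
  · refine absurd (IsTwin.eq hav hπ hv hi (z := z) fun x hx hxi => ⟨hz x hx, ?_⟩) (hz i hi)
    have := h x hx hxi
    rw [hbit x hx, Bool.eq_iff_iff] at this
    simpa using this
  · exact h

open Classical in
/-- Houses are excluded over five vertices: only none, all, or one end remain. -/
theorem IsPath.neighbours_five (hav : (⟨n, π⟩ : FinPerm) ∈ Av basisPerms) (hπ : IsSimple π)
    (hv : IsPath π 5 v) {z : Fin n} (hz : ∀ x < 5, z ≠ v x) :
    (∀ x < 5, ¬ Inverted π z (v x)) ∨ (∀ x < 5, Inverted π z (v x)) ∨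
      (∀ x < 5, Inverted π z (v x) ↔ x = 0) ∨ (∀ x < 5, Inverted π z (v x) ↔ x = 4) := by
  have hbit := fun x (hx : x < 5) => getD_five (fun x => decide (Inverted π z (v x))) hx
  have hf := (hv.realizes hz (b := fun x => [decide (Inverted π z (v 0)),
    decide (Inverted π z (v 1)), decide (Inverted π z (v 2)), decide (Inverted π z (v 3)),
      decide (Inverted π z (v 4))].getD x false)
    fun x hx => by rw [hbit x hx, decide_eq_true_eq]).refuted_eq_false hav
  rcases pathMatrix_five_refuted _ _ _ _ _ with h | ⟨s, hs, i, hi, h⟩ | h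
  · exact (Bool.false_ne_true (hf.symm.trans h)).elim
  · refine absurd (IsTwin.eq hav hπ (hv.shift (s := s) (m := 4) (by omega)) hi (z := z)
      fun x hx hxi => ⟨hz _ (by omega), ?_⟩) (hz _ (by omega))
    have := h x hx hxi
    rw [hbit _ (by omega), Bool.eq_iff_iff] at this
    simpa using this
  · simp only [List.mem_cons, List.cons.injEq, decide_eq_true_eq, decide_eq_false_iff_not,
      List.not_mem_nil, or_false, and_true] at h
    rcases h with h | h | h | h <;> obtain ⟨h₀, h₁, h₂, h₃, h₄⟩ := h
    · refine Or.inl fun x hx => ?_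
      interval_cases x <;> assumption
    · refine Or.inr (Or.inl fun x hx => ?_)
      interval_cases x <;> assumption
    · refine Or.inr (Or.inr (Or.inl fun x hx => ?_))
      interval_cases x <;> simp [*]
    · refine Or.inr (Or.inr (Or.inr fun x hx => ?_))
      interval_cases x <;> simp [*]

/-! ### Extending induced paths -/

/-- Far apart vertices of an induced path are ordered along the path. Both orders of the
permutation agree on non-adjacent vertices; `R` stands for this common order or its dual. -/
theorem IsPath.order {R : Fin n → Fin n → Prop} (hv : IsPath π k v)
    (htrans : ∀ {a b c}, R a b → R b c → R a c) (hadj : ∀ {a b}, R a b → ¬ Inverted π a b)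
    (htot : ∀ {a b}, a ≠ b → ¬ Inverted π a b → R a b ∨ R b a) (h₀ : R (v 0) (v 2)) :
    ∀ i j, i + 2 ≤ j → j < k → R (v i) (v j) := by
  have hA : ∀ i j, i + 2 ≤ j → j + 1 < k → R (v i) (v j) → R (v i) (v (j + 1)) := by
    intro i j hij hj h
    rcases htot (hv.inj (by omega : i < k) hj (by omega))
      (fun e => by rw [hv.inverted_iff (by omega) hj] at e; omega) with h' | h'
    · exact h'
    · exact (hadj (htrans h' h) ((hv.inverted_iff hj (by omega)).2 (Or.inr rfl))).elim
  have hB : ∀ i, i + 3 < k → R (v i) (v (i + 3)) → R (v (i + 1)) (v (i + 3)) := by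
    intro i hi h
    rcases htot (hv.inj (by omega : i + 1 < k) hi (by omega))
      (fun e => by rw [hv.inverted_iff (by omega) hi] at e; omega) with h' | h'
    · exact h'
    · exact (hadj (htrans h h')
        ((hv.inverted_iff (by omega) (by omega)).2 (Or.inl rfl))).elim
  have hC : ∀ i, i + 2 < k → R (v i) (v (i + 2)) := by
    intro i
    induction i with
    | zero => exact fun _ => h₀
    | succ i ih => exact fun hi => hB i hi (hA i (i + 2) le_rfl hi (ih (by omega)))
  intro i j hij
  induction j, hij using Nat.le_induction with
  | base => exact hC i
  | succ j hij ih => exact fun hj => hA i j hij hj (ih (by omega))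

theorem IsPath.order_below (hv : IsPath π k v) (hk : 3 ≤ k) :
    (∀ i j, i + 2 ≤ j → j < k → Below π (v i) (v j)) ∨
    (∀ i j, i + 2 ≤ j → j < k → Below π (v j) (v i)) := by
  rcases below_or_below (hv.inj (by omega) hk (by omega : 0 ≠ 2))
    (fun e => by rw [hv.inverted_iff (by omega) hk] at e; omega) with h | h
  · exact Or.inl (hv.order (R := Below π) Below.trans Below.not_inverted below_or_below h)
  · exact Or.inr (hv.order (R := fun a b => Below π b a) (fun h₁ h₂ => h₂.trans h₁)
      (fun h e => h.not_inverted e.symm) (fun h₁ h₂ => (below_or_below h₁ h₂).symm) h)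

/-- A vertex adjacent to both ends of a long induced path is adjacent to `v 2`: the inversion graph
of a permutation has no long induced cycles. -/
theorem IsPath.not_cycle (hv : IsPath π k v) (hk : 5 ≤ k) {z : Fin n} (hz : ∀ x < k, z ≠ v x)
    (h₀ : Inverted π z (v 0)) (h₁ : Inverted π z (v (k - 1)))
    (h : ¬ Inverted π z (v 2)) : False := by
  have hz2 := below_or_below (hz 2 (by omega)) h
  rcases hv.order_below (by omega) with ho | ho
  · rcases hz2 with h' | h'
    · exact (h'.trans (ho 2 (k - 1) (by omega) (by omega))).not_inverted h₁
    · exact ((ho 0 2 (by omega) (by omega)).trans h').not_inverted h₀.symm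
  · rcases hz2 with h' | h'
    · exact (h'.trans (ho 0 2 (by omega) (by omega))).not_inverted h₀
    · exact ((ho 2 (k - 1) (by omega) (by omega)).trans h').not_inverted h₁.symm

theorem IsPath.append (hv : IsPath π k v) {z : Fin n} (hz : ∀ x < k, z ≠ v x)
    (h : ∀ x < k, Inverted π z (v x) ↔ x + 1 = k) :
    IsPath π (k + 1) fun i => if i < k then v i else z := by
  intro i j hij hj
  have hi : i < k := by omega
  by_cases hj' : j < k
  · simpa [hi, hj'] using hv i j hij hj'
  · have := h i hi
    simp only [hi, hj', if_true, if_false]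
    rw [inverted_comm, this]
    exact ⟨(hz i hi).symm, by omega⟩

theorem IsPath.prepend (hv : IsPath π k v) {z : Fin n} (hz : ∀ x < k, z ≠ v x)
    (h : ∀ x < k, Inverted π z (v x) ↔ x = 0) :
    IsPath π (k + 1) fun i => if i = 0 then z else v (i - 1) := by
  intro i j hij hj
  have hj0 : j ≠ 0 := by omega
  by_cases hi : i = 0
  · subst hi
    simp only [hj0, if_true, if_false]
    exact ⟨hz _ (by omega), (h _ (by omega)).trans (by omega)⟩
  · simp only [hi, hj0, if_false]
    have := hv (i - 1) (j - 1) (by omega) (by omega)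
    exact ⟨this.1, this.2.trans (by omega)⟩

/-- The vertices of an induced path are not a module, unless they are all vertices. -/
theorem IsPath.exists_distinguishing (hπ : IsSimple π) (hv : IsPath π k v) (hk : 2 ≤ k)
    (hkn : k < n) : ∃ z, (∀ x < k, z ≠ v x) ∧ (∃ x < k, Inverted π z (v x)) ∧
      ∃ y < k, ¬ Inverted π z (v y) := by
  by_contra hno
  push Not at hno
  have hmod : IsModule π {z | ∃ x < k, z = v x} := by
    rintro z hz _ ⟨x, hx, rfl⟩ _ ⟨y, hy, rfl⟩ h
    exact hno z (fun x hx e => hz ⟨x, hx, e⟩) ⟨x, hx, h⟩ y hy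
  rcases hπ.prime hmod with h | h
  · exact hv.inj (by omega) hk (by omega : 0 ≠ 1) (h ⟨0, by omega, rfl⟩ ⟨1, hk, rfl⟩)
  · have hsurj : Function.Surjective fun i : Fin k => v i := by
      intro z
      have : z ∈ {z | ∃ x < k, z = v x} := h ▸ Set.mem_univ z
      obtain ⟨x, hx, rfl⟩ := this
      exact ⟨⟨x, hx⟩, rfl⟩
    have := Fintype.card_le_of_surjective _ hsurj
    simp only [Fintype.card_fin] at this
    omega

/-- In a simple permutation that avoids the basis, induced paths with at least five vertices
extend, as long as they do not contain all entries. -/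
theorem IsPath.extend (hav : (⟨n, π⟩ : FinPerm) ∈ Av basisPerms) (hπ : IsSimple π)
    (hv : IsPath π k v) (hk : 5 ≤ k) (hkn : k < n) : ∃ w, IsPath π (k + 1) w := by
  obtain ⟨z, hz, ⟨a, hak, ha⟩, b, hbk, hb⟩ := hv.exists_distinguishing hπ (by omega) hkn
  have hwin : ∀ s, s + 5 ≤ k → (∀ x < 5, ¬ Inverted π z (v (x + s))) ∨
      (∀ x < 5, Inverted π z (v (x + s))) ∨
      (∀ x < 5, Inverted π z (v (x + s)) ↔ x = 0) ∨
      (∀ x < 5, Inverted π z (v (x + s)) ↔ x = 4) := fun s hs =>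
    (hv.shift hs).neighbours_five hav hπ fun x hx => hz _ (by omega)
  -- If `z` has no neighbours among `v 1, …, v 3`, then it has none among `v 1, …, v (k - 2)`.
  have hmid : (∀ x, 1 ≤ x → x ≤ 3 → ¬ Inverted π z (v x)) →
      ∀ x, 1 ≤ x → x + 1 < k → ¬ Inverted π z (v x) := by
    intro h x
    induction x using Nat.strong_induction_on with
    | _ x ih =>
      intro hx hxk hinv
      rcases le_or_gt x 3 with hx3 | hx3
      · exact h x hx hx3 hinv
      · obtain ⟨y, rfl⟩ := Nat.exists_eq_add_of_le hx3.le
        have h₁ := ih (2 + y) (by omega) (by omega) (by omega)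
        rcases hwin y (by omega) with h₂ | h₂ | h₂ | h₂
        · exact h₂ 3 (by omega) hinv
        · exact h₁ (h₂ 2 (by omega))
        · exact absurd ((h₂ 3 (by omega)).1 hinv) (by omega)
        · exact absurd ((h₂ 3 (by omega)).1 hinv) (by omega)
  have hmid' : ∀ x, 1 ≤ x → x + 1 < k → ¬ Inverted π z (v x) := by
    rcases hwin 0 (by omega) with h | h | h | h
    · exact hmid fun x _ hx => h x (by omega)
    · have hall : ∀ x < k, Inverted π z (v x) := by
        intro x
        induction x using Nat.strong_induction_on with
        | _ x ih =>
          intro hx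
          rcases lt_or_ge x 5 with hx5 | hx5
          · exact h x hx5
          · obtain ⟨y, rfl⟩ := Nat.exists_eq_add_of_le (by omega : 4 ≤ x)
            have i₀ := ih (0 + y) (by omega) (by omega)
            have i₁ := ih (1 + y) (by omega) (by omega)
            rcases hwin y (by omega) with h₂ | h₂ | h₂ | h₂
            · exact (h₂ 0 (by omega) i₀).elim
            · exact h₂ 4 (by omega)
            · exact absurd ((h₂ 1 (by omega)).1 i₁) (by omega)
            · exact absurd ((h₂ 0 (by omega)).1 i₀) (by omega)
      exact (hb (hall b hbk)).elim
    · exact hmid fun x hx hx' e => absurd ((h x (by omega)).1 e) (by omega)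
    · exact hmid fun x hx hx' e => absurd ((h x (by omega)).1 e) (by omega)
  by_cases h0 : Inverted π z (v 0)
  · by_cases h1 : Inverted π z (v (k - 1))
    · exact (hv.not_cycle hk hz h0 h1 (hmid' 2 (by omega) (by omega))).elim
    · refine ⟨_, hv.prepend hz fun x hx => ⟨fun e => ?_, fun e => e ▸ h0⟩⟩
      by_contra hx0
      rcases (by omega : x + 1 < k ∨ x = k - 1) with h | rfl
      · exact hmid' x (by omega) h e
      · exact h1 e
  · have hlast : ∀ x < k, Inverted π z (v x) → x + 1 = k := by
      intro x hx e
      by_contra hne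
      rcases Nat.eq_zero_or_pos x with rfl | hpos
      · exact h0 e
      · exact hmid' x hpos (by omega) e
    refine ⟨_, hv.append hz fun x hx => ⟨hlast x hx, fun e => ?_⟩⟩
    have := hlast a hak ha
    rwa [show x = a by omega]

theorem IsPath.exists_covering (hav : (⟨n, π⟩ : FinPerm) ∈ Av basisPerms) (hπ : IsSimple π)
    (hv : IsPath π 5 v) : ∃ w, IsPath π n w := by
  have h : ∀ k, 5 ≤ k → k ≤ n → ∃ w, IsPath π k w := by
    intro k hk
    induction k, hk using Nat.le_induction with
    | base => exact fun _ => ⟨v, hv⟩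
    | succ k hk ih =>
      intro hkn
      obtain ⟨w, hw⟩ := ih (by omega)
      exact hw.extend hav hπ hk hkn
  exact h n hv.card_le le_rfl

/-! ### Reversal -/

theorem inverted_revPerm_trans {i j : Fin n} :
    Inverted (Fin.revPerm.trans π) i j ↔ i ≠ j ∧ ¬ Inverted π (Fin.rev i) (Fin.rev j) := by
  have h' : i ≠ j → π (Fin.rev i) ≠ π (Fin.rev j) := fun hne h' =>
    hne (Fin.rev_injective (π.injective h'))
  simp only [Inverted, Equiv.trans_apply, Fin.revPerm_apply, Fin.rev_lt_rev]
  grind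

theorem IsSimple.revPerm_trans (h : IsSimple π) : IsSimple (Fin.revPerm.trans π) := by
  intro S hS
  have hI : IsIntvl π {x | Fin.rev x ∈ S} := by
    intro a ha b hb c
    refine ⟨fun h₁ h₂ => ?_, fun h₁ h₂ => ?_⟩
    · exact (hS _ hb _ ha (Fin.rev c)).1 (Fin.rev_lt_rev.2 h₂) (Fin.rev_lt_rev.2 h₁)
    · have := (hS _ ha _ hb (Fin.rev c)).2
      simp only [Equiv.trans_apply, Fin.revPerm_apply, Fin.rev_rev] at this
      exact this h₁ h₂
  rcases h _ hI with h | h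
  · left
    intro x hx y hy
    exact Fin.rev_injective (h (by simpa using hx) (by simpa using hy))
  · right
    ext x
    have : Fin.rev x ∈ {x | Fin.rev x ∈ S} := h ▸ Set.mem_univ _
    simpa using this

theorem reverse_mem_Av {π : FinPerm} (h : π ∈ Av basisPerms) : reverse π ∈ Av basisPerms := by
  intro β hβ hc
  refine h _ (reverse_mem_basisPerms hβ) ?_
  simpa [reverse_reverse] using hc.reverse

/-- A house (the complement of an induced path with five vertices) gives an induced path in the
reversal. -/
theorem isPath_five_reverse {a b c d e : Fin n} (hab : a ≠ b) (hbc : b ≠ c) (hcd : c ≠ d)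
    (hde : d ≠ e) (h₁ : ¬ Inverted π a b) (h₂ : ¬ Inverted π b c) (h₃ : ¬ Inverted π c d)
    (h₄ : ¬ Inverted π d e) (hac : Inverted π a c) (had : Inverted π a d) (hae : Inverted π a e)
    (hbd : Inverted π b d) (hbe : Inverted π b e) (hce : Inverted π c e) :
    IsPath (Fin.revPerm.trans π) 5 fun i => Fin.rev ([a, b, c, d, e].getD i a) := by
  intro i j hij hj
  have := hac.ne
  have := had.ne
  have := hae.ne
  have := hbd.ne
  have := hbe.ne
  have := hce.ne
  interval_cases j <;> interval_cases i <;> simp_all [inverted_revPerm_trans]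

/-- A simple permutation that avoids the basis, or its reversal, is an induced path. -/
theorem IsSimple.exists_covering_path (hav : (⟨n, π⟩ : FinPerm) ∈ Av basisPerms)
    (hπ : IsSimple π) (hn : 3 ≤ n) :
    4 ≤ n ∧ ((∃ w, IsPath π n w) ∨ ∃ w, IsPath (Fin.revPerm.trans π) n w) := by
  obtain ⟨v, hv⟩ := hπ.exists_path_four hn
  refine ⟨hv.card_le, ?_⟩
  rcases hv.card_le.eq_or_lt with rfl | hlt
  · exact Or.inl ⟨v, hv⟩
  obtain ⟨z, hz, ⟨a, hak, ha⟩, b, hbk, hb⟩ := hv.exists_distinguishing hπ (by omega) hlt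
  have h := hv.neighbours_four hav hπ hz
  simp only [List.mem_cons, List.cons.injEq, decide_eq_true_eq, decide_eq_false_iff_not,
    List.not_mem_nil, or_false, and_true] at h
  have h01 := (hv 0 1 (by omega) (by omega)).2.2 rfl
  have h12 := (hv 1 2 (by omega) (by omega)).2.2 rfl
  have h23 := (hv 2 3 (by omega) (by omega)).2.2 rfl
  have h02 := hv 0 2 (by omega) (by omega)
  have h13 := hv 1 3 (by omega) (by omega)
  have h03 := hv 0 3 (by omega) (by omega)
  have n02 : ¬ Inverted π (v 0) (v 2) := fun e => by simpa using h02.2.1 e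
  have n13 : ¬ Inverted π (v 1) (v 3) := fun e => by simpa using h13.2.1 e
  have n03 : ¬ Inverted π (v 0) (v 3) := fun e => by simpa using h03.2.1 e
  have hrev := reverse_mem_Av hav
  rcases h with h | h | h | h | h | h
  · interval_cases a <;> tauto
  · interval_cases b <;> tauto
  · refine Or.inl ((hv.prepend hz fun x hx => ?_).exists_covering hav hπ)
    interval_cases x <;> simp [h]
  · refine Or.inl ((hv.append hz fun x hx => ?_).exists_covering hav hπ)
    interval_cases x <;> simp [h]
  · exact Or.inr ((isPath_five_reverse (a := v 1) (b := v 3) (c := v 0) (d := v 2) (e := z)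
      h13.1 h03.1.symm h02.1 (hz 2 (by omega)).symm n13 (fun e => n03 e.symm) n02
      (fun e => h.2.2.1 e.symm) h01.symm h12 h.2.1.symm h23.symm h.2.2.2.symm
      h.1.symm).exists_covering hrev hπ.revPerm_trans)
  · exact Or.inr ((isPath_five_reverse (a := v 2) (b := v 0) (c := v 3) (d := v 1) (e := z)
      h02.1.symm h03.1 h13.1.symm (hz 1 (by omega)).symm (fun e => n02 e.symm) n03
      (fun e => n13 e.symm) (fun e => h.2.1 e.symm) h23 h12.symm h.2.2.1.symm h01 h.1.symm
      h.2.2.2.symm).exists_covering hrev hπ.revPerm_trans)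

end Paths

/-! ### Paths are oscillations -/

section Oscillations

variable {n : ℕ} {π : Equiv.Perm (Fin n)} {v : ℕ → Fin n} {k : ℕ}

theorem oscSeq_eq (k : ℕ) : oscSeq k = if k % 2 = 0 then k + 4 else k := by
  simp [oscSeq, Nat.even_iff]

theorem IsPath.reversePath (hv : IsPath π k v) : IsPath π k fun i => v (k - 1 - i) := by
  intro i j hij hj
  refine ⟨hv.inj (by omega) (by omega) (by omega), ?_⟩
  rw [hv.inverted_iff (by omega) (by omega)]
  omega

theorem IsPath.exists_ordered (hv : IsPath π k v) (hk : 3 ≤ k) :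
    ∃ w, IsPath π k w ∧ ∀ i j, i + 2 ≤ j → j < k → Below π (w i) (w j) := by
  rcases hv.order_below hk with h | h
  · exact ⟨v, hv, h⟩
  · exact ⟨_, hv.reversePath, fun i j hij hj => h _ _ (by omega) (by omega)⟩

/-- Along an ordered induced path, the vertices are alternately to the right of and to the left of
both their neighbours. -/
theorem IsPath.alternating (hv : IsPath π k v)
    (ho : ∀ i j, i + 2 ≤ j → j < k → Below π (v i) (v j)) :
    ∃ s ≤ 1, ∀ t, t + 1 < k → (v (t + 1) < v t ↔ (t + s) % 2 = 0) := by
  have hstep : ∀ t, t + 2 < k → (v (t + 2) < v (t + 1) ↔ ¬ v (t + 1) < v t) := by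
    intro t ht
    have h₁ := (hv.inverted_iff (by omega : t < k) (by omega : t + 1 < k)).2 (Or.inl rfl)
    have h₂ := (hv.inverted_iff (by omega : t + 1 < k) ht).2 (Or.inl rfl)
    have h₃ := ho t (t + 2) le_rfl ht
    simp only [Inverted, Below] at h₁ h₂ h₃
    grind
  by_cases h₀ : v 1 < v 0
  · refine ⟨0, by omega, fun t => ?_⟩
    induction t with
    | zero => simpa using fun _ => h₀
    | succ t ih =>
      intro ht
      rw [hstep t ht, ih (by omega)]
      omega
  · refine ⟨1, le_rfl, fun t => ?_⟩
    induction t with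
    | zero => simpa using fun _ => h₀
    | succ t ih =>
      intro ht
      rw [hstep t ht, ih (by omega)]
      omega

/-- A permutation whose inversion graph is a path is contained in the increasing oscillating
sequence: the inversion graph of that sequence is the path through the indices
`1, 0, 3, 2, 5, 4, …`. -/
theorem IsPath.exists_embedding (hv : IsPath π n v) (hn : 3 ≤ n) :
    ∃ f : Fin n → ℕ, StrictMono f ∧ ∀ i j, π i < π j ↔ oscSeq (f i) < oscSeq (f j) := by
  obtain ⟨w, hw, ho⟩ := hv.exists_ordered hn
  obtain ⟨s, hs, halt⟩ := hw.alternating ho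
  -- The `x`-th path vertex is sent to the index `pos x`, where the sequence has the value `val x`;
  -- the shift `s` adjusts the parity so that the vertices to the right of their neighbours go to
  -- odd indices.
  let pos : ℕ → ℕ := fun x => if (x + s) % 2 = 0 then x + s + 1 else x + s - 1
  let val : ℕ → ℕ := fun x => if (x + s) % 2 = 0 then x + s + 1 else x + s + 3
  have hval : ∀ x, oscSeq (pos x) = val x := by
    intro x
    simp only [pos, val, oscSeq_eq]
    split_ifs <;> omega
  have key : ∀ x y, x < y → y < n →
      ((w x < w y ∧ pos x < pos y) ∨ (w y < w x ∧ pos y < pos x)) ∧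
      ((π (w x) < π (w y) ∧ val x < val y) ∨ (π (w y) < π (w x) ∧ val y < val x)) := by
    intro x y hxy hy
    rcases (by omega : x + 2 ≤ y ∨ y = x + 1) with h | rfl
    · have hb := ho x y h hy
      refine ⟨Or.inl ⟨hb.1, ?_⟩, Or.inl ⟨hb.2, ?_⟩⟩
      · simp only [pos]
        split_ifs <;> omega
      · simp only [val]
        split_ifs <;> omega
    · have hinv := (hw.inverted_iff (by omega : x < n) hy).2 (Or.inl rfl)
      have hx := halt x hy
      by_cases hp : (x + s) % 2 = 0
      · have hlt := hx.2 hp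
        have hp' : ¬ (x + 1 + s) % 2 = 0 := by omega
        refine ⟨Or.inr ⟨hlt, ?_⟩, Or.inl ⟨?_, ?_⟩⟩
        · simp only [pos, hp, hp', if_true, if_false]
          omega
        · rcases hinv with h | h
          · exact (lt_asymm h.1 hlt).elim
          · exact h.2
        · simp only [val, hp, hp', if_true, if_false]
          omega
      · have hp' : (x + 1 + s) % 2 = 0 := by omega
        have hnlt : ¬ w (x + 1) < w x := fun h => hp (hx.1 h)
        have h : w x < w (x + 1) ∧ π (w (x + 1)) < π (w x) := by
          rcases hinv with h | h
          · exact h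
          · exact (hnlt h.1).elim
        refine ⟨Or.inl ⟨h.1, ?_⟩, Or.inr ⟨h.2, ?_⟩⟩
        · simp only [pos, hp, hp', if_true, if_false]
          omega
        · simp only [val, hp, hp', if_true, if_false]
          omega
  have hinj : Function.Injective fun i : Fin n => w i := by
    intro i j hij
    by_contra hne
    exact hw.inj i.2 j.2 (fun e => hne (Fin.ext e)) hij
  have hsurj : ∀ i, ∃ t : Fin n, w t = i := Finite.surjective_of_injective hinj
  choose t ht using hsurj
  have key' : ∀ i j, i ≠ j →
      ((i < j ∧ pos (t i) < pos (t j)) ∨ (j < i ∧ pos (t j) < pos (t i))) ∧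
      ((π i < π j ∧ val (t i) < val (t j)) ∨ (π j < π i ∧ val (t j) < val (t i))) := by
    intro i j hij
    have hne : (t i : ℕ) ≠ t j := fun e => hij (by rw [← ht i, ← ht j, e])
    rcases lt_or_gt_of_ne hne with h | h
    · have := key _ _ h (t j).2
      rwa [ht i, ht j] at this
    · have := key _ _ h (t i).2
      rw [ht i, ht j] at this
      exact ⟨this.1.symm, this.2.symm⟩
  refine ⟨fun i => pos (t i), fun i j hij => ?_, fun i j => ?_⟩
  · rcases (key' i j hij.ne).1 with h | h
    · exact h.2
    · exact (lt_asymm hij h.1).elim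
  · simp only [hval]
    by_cases hij : i = j
    · subst hij
      simp
    · rcases (key' i j hij).2 with h | h
      · exact iff_of_true h.1 h.2
      · exact iff_of_false h.1.not_gt h.2.not_gt

theorem IsDirectSum.exists_below {ρ σ τ : FinPerm} (h : IsDirectSum ρ σ τ) (hρ : 0 < ρ.1)
    (hσ : 0 < σ.1) : ∃ S : Set (Fin τ.1), S.Nonempty ∧ Sᶜ.Nonempty ∧
      ∀ a ∈ S, ∀ b ∉ S, Below τ.2 a b := by
  obtain ⟨e, -, h₁, -, h₂⟩ := h
  refine ⟨{x | (e.symm x).1 = (0 : Fin 2)}, ⟨e ⟨(0 : Fin 2), ⟨0, hρ⟩⟩, by simp⟩,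
    ⟨e ⟨(1 : Fin 2), ⟨0, hσ⟩⟩, by simp⟩, fun a ha b hb => ?_⟩
  obtain ⟨⟨i, a⟩, rfl⟩ := e.surjective a
  obtain ⟨⟨j, b⟩, rfl⟩ := e.surjective b
  simp only [Set.mem_ofPred_eq, Equiv.symm_apply_apply] at ha hb
  have hij : i < j := by
    rw [ha]
    exact Fin.pos_iff_ne_zero.2 hb
  exact ⟨h₁ i j a b hij, h₂ i j a b hij⟩

theorem sumIndecomposable_of_isSimple {τ : FinPerm} (h : IsSimple τ.2) (hn : 3 ≤ τ.1) :
    SumIndecomposable τ := by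
  intro ρ σ hρ hσ hsum
  obtain ⟨S, ⟨a, ha⟩, ⟨b, hb⟩, hS⟩ := hsum.exists_below hρ hσ
  have hI : IsIntvl τ.2 S := by
    intro x hx y hy c
    refine ⟨fun _ h₂ => ?_, fun _ h₂ => ?_⟩ <;> by_contra hc
    · exact lt_asymm h₂ (hS y hy c hc).1
    · exact lt_asymm h₂ (hS y hy c hc).2
  have hI' : IsIntvl τ.2 Sᶜ := by
    intro x hx y hy c
    refine ⟨fun h₁ _ hc => ?_, fun h₁ _ hc => ?_⟩
    · exact lt_asymm h₁ (hS c hc x hx).1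
    · exact lt_asymm h₁ (hS c hc x hx).2
  have h₁ : S.Subsingleton := (h S hI).resolve_right fun e => hb (e ▸ Set.mem_univ b)
  have h₂ : Sᶜ.Subsingleton := (h Sᶜ hI').resolve_right fun e =>
    (e ▸ Set.mem_univ a : a ∈ Sᶜ) ha
  have hcard : (Finset.univ : Finset (Fin τ.1)) ⊆ {a, b} := by
    intro x _
    simp only [Finset.mem_insert, Finset.mem_singleton]
    by_cases hx : x ∈ S
    · exact Or.inl (h₁ hx ha)
    · exact Or.inr (h₂ hx hb)
  have := (Finset.card_le_card hcard).trans Finset.card_le_two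
  simp only [Finset.card_univ, Fintype.card_fin] at this
  omega

/-- The permutations of length at most two without a non-inversion: the empty one, 1 and 21. -/
theorem isIncreasingOscillation_of_no_below {π : FinPerm} (hn : π.1 ≤ 2)
    (h : ∀ a b, ¬ Below π.2 a b) : IsIncreasingOscillation π := by
  refine ⟨fun ρ σ hρ hσ hsum => ?_, fun i => i, fun i j hij => hij, fun i j => ?_⟩
  · obtain ⟨S, ⟨a, ha⟩, ⟨b, hb⟩, hS⟩ := hsum.exists_below hρ hσ
    exact h a b (hS a ha b hb)
  · rcases lt_trichotomy i j with hij | rfl | hij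
    · refine iff_of_false (fun e => h i j ⟨hij, e⟩) ?_
      have hi : (i : ℕ) = 0 := by omega
      have hj : (j : ℕ) = 1 := by omega
      simp only [hi, hj]
      decide
    · simp
    · have hne : π.2 i ≠ π.2 j := fun e => hij.ne' (π.2.injective e)
      refine iff_of_true ((lt_or_gt_of_ne hne).resolve_right fun e => h j i ⟨hij, e⟩) ?_
      have hi : (i : ℕ) = 1 := by omega
      have hj : (j : ℕ) = 0 := by omega
      simp only [hi, hj]
      decide

theorem isOscillation_of_length_le_two {π : FinPerm} (hn : π.1 ≤ 2) : IsOscillation π := by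
  by_cases h : ∀ a b, ¬ Below π.2 a b
  · exact Or.inl (isIncreasingOscillation_of_no_below hn h)
  · push Not at h
    obtain ⟨a, b, hab⟩ := h
    have key : ∀ c d : Fin π.1, c < d → ¬ π.2 (Fin.rev c) < π.2 (Fin.rev d) := by
      intro c d hcd h'
      have hcd' := Fin.rev_lt_rev.2 hcd
      have := hab.1
      have e₁ : Fin.rev d = a := by ext; omega
      have e₂ : Fin.rev c = b := by ext; omega
      rw [e₁, e₂] at h'
      exact lt_asymm hab.2 h'
    exact Or.inr ⟨reverse π, isIncreasingOscillation_of_no_below hn fun c d hcd =>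
      key c d hcd.1 hcd.2, (reverse_reverse π).symm⟩

/-- Simple permutations that avoid the basis are oscillations. -/
theorem isOscillation_of_isSimple {π : FinPerm} (hav : π ∈ Av basisPerms) (hπ : IsSimple π.2)
    (hn : 3 ≤ π.1) : IsOscillation π := by
  obtain ⟨h4, ⟨w, hw⟩ | ⟨w, hw⟩⟩ := IsSimple.exists_covering_path hav hπ hn
  · exact Or.inl ⟨sumIndecomposable_of_isSimple hπ hn, hw.exists_embedding hn⟩
  · exact Or.inr ⟨reverse π, ⟨sumIndecomposable_of_isSimple hπ.revPerm_trans hn,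
      hw.exists_embedding hn⟩, (reverse_reverse π).symm⟩

/-! ### Oscillations avoid the basis -/

/-- Every basis word contains 321, 2341, 4123 or 3412. -/
theorem basisWords_contain : ∀ l ∈ basisWords,
    (∃ a < l.length, ∃ b < a, ∃ c < b, l.getD a 0 < l.getD b 0 ∧ l.getD b 0 < l.getD c 0) ∨
    (∃ a < l.length, ∃ b < a, ∃ c < b, ∃ d < c,
      (l.getD a 0 < l.getD d 0 ∧ l.getD d 0 < l.getD c 0 ∧ l.getD c 0 < l.getD b 0) ∨
      (l.getD c 0 < l.getD b 0 ∧ l.getD b 0 < l.getD a 0 ∧ l.getD a 0 < l.getD d 0) ∨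
      (l.getD b 0 < l.getD a 0 ∧ l.getD a 0 < l.getD d 0 ∧ l.getD d 0 < l.getD c 0)) := by
  decide +kernel

theorem getD_oneLine (π : FinPerm) {i : ℕ} (h : i < π.1) :
    (oneLine π).getD i 0 = (π.2 ⟨i, h⟩ : ℕ) + 1 := by
  rw [List.getD_eq_getElem _ _ (by rwa [length_oneLine]), getElem_oneLine]

theorem not_embedding_of_mem_basisPerms {β : FinPerm} (hβ : β ∈ basisPerms) (f : Fin β.1 → ℕ)
    (hf : StrictMono f) (h : ∀ i j, β.2 i < β.2 j ↔ oscSeq (f i) < oscSeq (f j)) : False := by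
  have hlt : ∀ i j (hi : i < β.1) (hj : j < β.1), (oneLine β).getD i 0 < (oneLine β).getD j 0 →
      oscSeq (f ⟨i, hi⟩) < oscSeq (f ⟨j, hj⟩) := by
    intro i j hi hj hij
    rw [getD_oneLine β hi, getD_oneLine β hj] at hij
    exact (h _ _).1 (by rw [Fin.lt_def]; omega)
  have hf' : ∀ i j (hi : i < β.1) (hj : j < β.1), i < j → f ⟨i, hi⟩ < f ⟨j, hj⟩ :=
    fun i j hi hj hij => hf hij
  simp only [oscSeq_eq] at hlt
  have hw := basisWords_contain _ hβ
  rw [length_oneLine] at hw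
  rcases hw with ⟨a, ha, b, hb, c, hc, h₁, h₂⟩ | ⟨a, ha, b, hb, c, hc, d, hd, hw⟩
  · have hb' : b < β.1 := by omega
    have hc' : c < β.1 := by omega
    replace h₁ := hlt _ _ ha hb' h₁
    replace h₂ := hlt _ _ hb' hc' h₂
    have i₁ := hf' _ _ hb' ha hb
    have i₂ := hf' _ _ hc' hb' hc
    split_ifs at h₁ h₂ <;> omega
  · have hb' : b < β.1 := by omega
    have hc' : c < β.1 := by omega
    have hd' : d < β.1 := by omega
    have i₁ := hf' _ _ hb' ha hb
    have i₂ := hf' _ _ hc' hb' hc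
    have i₃ := hf' _ _ hd' hc' hd
    rcases hw with ⟨h₁, h₂, h₃⟩ | ⟨h₁, h₂, h₃⟩ | ⟨h₁, h₂, h₃⟩
    · replace h₁ := hlt _ _ ha hd' h₁
      replace h₂ := hlt _ _ hd' hc' h₂
      replace h₃ := hlt _ _ hc' hb' h₃
      split_ifs at h₁ h₂ h₃ <;> omega
    · replace h₁ := hlt _ _ hc' hb' h₁
      replace h₂ := hlt _ _ hb' ha h₂
      replace h₃ := hlt _ _ ha hd' h₃
      split_ifs at h₁ h₂ h₃ <;> omega
    · replace h₁ := hlt _ _ hb' ha h₁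
      replace h₂ := hlt _ _ ha hd' h₂
      replace h₃ := hlt _ _ hd' hc' h₃
      split_ifs at h₁ h₂ h₃ <;> omega

theorem not_contained_increasing {β ω : FinPerm} (hβ : β ∈ basisPerms)
    (hω : IsIncreasingOscillation ω) : ¬ Contained β ω := by
  rintro ⟨g, hg, hg'⟩
  obtain ⟨-, f, hf, hf'⟩ := hω
  exact not_embedding_of_mem_basisPerms hβ (f ∘ g) (hf.comp hg) fun i j =>
    (hg' i j).trans (hf' _ _)

theorem oscillationClass_subset_Av : oscillationClass ⊆ Av basisPerms := by
  rintro π ⟨ω, hω, hc⟩ β hβ hβπ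
  rcases hω with hω | ⟨ρ, hρ, rfl⟩
  · exact not_contained_increasing hβ hω (hβπ.trans hc)
  · refine not_contained_increasing (reverse_mem_basisPerms hβ) hρ ?_
    simpa [reverse_reverse] using (hβπ.trans hc).reverse

end Oscillations

/-! ### Wreath closure and simple permutations -/

/-- A class defined by avoiding simple permutations is wreath-closed: a simple permutation
contained in an inflation lies in a single block or meets each block at most once. -/
theorem isWreathClosed_Av {B : Set FinPerm} (hB : ∀ β ∈ B, IsSimple β.2) :
    IsWreathClosed (Av B) := by
  refine ⟨fun π hπ σ hσ β hβ hc => hπ β hβ (hc.trans hσ), ?_⟩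
  rintro σ α τ hσ hα - ⟨e, h₁, h₂, h₃, h₄⟩ β hβ ⟨f, hf, hf'⟩
  let b : Fin β.1 → Fin σ.1 := fun i => (e.symm (f i)).1
  have hb : ∀ i, ∃ a, e ⟨b i, a⟩ = f i := fun i => ⟨(e.symm (f i)).2, e.apply_symm_apply (f i)⟩
  have hpos : ∀ i j, b i < b j → i < j := by
    intro i j hij
    obtain ⟨x, hx⟩ := hb i
    obtain ⟨y, hy⟩ := hb j
    have := h₂ _ _ x y hij
    rwa [hx, hy, hf.lt_iff_lt] at this
  have hval : ∀ i j, σ.2 (b i) < σ.2 (b j) → β.2 i < β.2 j := by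
    intro i j hij
    obtain ⟨x, hx⟩ := hb i
    obtain ⟨y, hy⟩ := hb j
    have := h₄ _ _ x y hij
    rwa [hx, hy, ← hf'] at this
  by_cases hu : ∃ j, ∀ i, b i = j
  · obtain ⟨j, hj⟩ := hu
    have hg : ∀ i, ∃ a, e ⟨j, a⟩ = f i := fun i => hj i ▸ hb i
    choose g hg using hg
    refine hα j β hβ ⟨g, fun i i' hii => ?_, fun i i' => ?_⟩
    · by_contra hle
      rcases (not_lt.1 hle).eq_or_lt with heq | hlt
      · have : f i' = f i := by rw [← hg, ← hg, heq]
        exact hii.ne' (hf.injective this)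
      · have := h₁ j _ _ hlt
        rw [hg, hg] at this
        exact lt_asymm this (hf hii)
    · have hmono : ∀ i i', (α j).2 (g i) < (α j).2 (g i') → β.2 i < β.2 i' := by
        intro i i' h
        have := h₃ j _ _ h
        rwa [hg, hg, ← hf'] at this
      refine ⟨fun h => ?_, hmono i i'⟩
      by_contra hle
      rcases (not_lt.1 hle).eq_or_lt with heq | hlt
      · have : f i' = f i := by rw [← hg, ← hg, (α j).2.injective heq]
        exact h.ne' (congrArg β.2 (hf.injective this))
      · exact lt_asymm h (hmono i' i hlt)
  · have hinj : ∀ i i', b i = b i' → i = i' := by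
      intro i i' hii
      have hI : IsIntvl β.2 {x | b x = b i} := by
        intro x hx y hy c
        rw [Set.mem_ofPred_eq] at hx hy
        constructor <;> intro h h' <;> by_contra hc
        · rcases lt_or_gt_of_ne hc with hlt | hlt
          · exact lt_asymm h (hpos c x (hx ▸ hlt))
          · exact lt_asymm h' (hpos y c (hy ▸ hlt))
        · rcases lt_or_gt_of_ne (fun e' => hc (σ.2.injective e')) with hlt | hlt
          · exact lt_asymm h (hval c x (hx ▸ hlt))
          · exact lt_asymm h' (hval y c (hy ▸ hlt))
      rcases hB β hβ _ hI with h | h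
      · exact h rfl hii.symm
      · exact (hu ⟨b i, fun x => (h ▸ Set.mem_univ x : x ∈ {x | b x = b i})⟩).elim
    refine hσ β hβ ⟨b, fun i j hij => ?_, fun i j => ⟨fun h => ?_, hval i j⟩⟩
    · by_contra hle
      rcases (not_lt.1 hle).eq_or_lt with heq | hlt
      · exact hij.ne (hinj _ _ heq.symm)
      · exact lt_asymm hij (hpos _ _ hlt)
    · by_contra hle
      rcases (not_lt.1 hle).eq_or_lt with heq | hlt
      · exact h.ne' (congrArg β.2 (hinj _ _ (σ.2.injective heq)))
      · exact lt_asymm h (hval _ _ hlt)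

/-- A block map onto the entries of `σ` that respects both orders presents `π` as an inflation of
`σ` by the patterns of its fibres. -/
theorem exists_isInflation {n : ℕ} (π : Equiv.Perm (Fin n)) (σ : FinPerm) (g : Fin n → Fin σ.1)
    (hg : Function.Surjective g) (hg' : ∀ c, ∃ x, g x ≠ c) (hpos : ∀ x y, g x < g y → x < y)
    (hval : ∀ x y, σ.2 (g x) < σ.2 (g y) → π x < π y) :
    ∃ α : Fin σ.1 → FinPerm, IsInflation σ α ⟨n, π⟩ ∧
      ∀ i, 0 < (α i).1 ∧ (α i).1 < n ∧ Contained (α i) ⟨n, π⟩ := by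
  let F : Fin σ.1 → Finset (Fin n) := fun i => Finset.univ.filter fun x => g x = i
  have hF : ∀ i x, x ∈ F i ↔ g x = i := by simp [F]
  choose τ hτ using fun i => exists_pattern π ((F i).orderEmbOfFin rfl)
    ((F i).orderEmbOfFin rfl).injective
  let e : (Σ i : Fin σ.1, Fin (F i).card) ≃ Fin n :=
    (Equiv.sigmaCongrRight fun i => ((F i).orderIsoOfFin rfl).toEquiv.trans
      (Equiv.subtypeEquivRight (hF i))).trans (Equiv.sigmaFiberEquiv g)
  have he : ∀ i a, e ⟨i, a⟩ = (F i).orderEmbOfFin rfl a := fun i a => rfl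
  have hge : ∀ i a, g (e ⟨i, a⟩) = i := fun i a =>
    (hF i _).1 ((F i).orderEmbOfFin_mem rfl a)
  refine ⟨fun i => ⟨(F i).card, τ i⟩, ⟨e, ?_, ?_, ?_, ?_⟩, fun i => ⟨?_, ?_, ?_⟩⟩
  · intro i a b hab
    rw [he, he]
    exact ((F i).orderEmbOfFin rfl).strictMono hab
  · intro i j a b hij
    apply hpos
    rwa [hge i a, hge j b]
  · intro i a b hab
    rw [he, he]
    exact (hτ i a b).1 hab
  · intro i j a b hij
    apply hval
    rwa [hge i a, hge j b]
  · obtain ⟨x, hx⟩ := hg i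
    exact Finset.card_pos.2 ⟨x, (hF i x).2 hx⟩
  · obtain ⟨x, hx⟩ := hg' i
    have hlt : F i ⊂ Finset.univ := Finset.ssubset_univ_iff.2 fun h =>
      hx ((hF i x).1 (h ▸ Finset.mem_univ x))
    simpa using Finset.card_lt_card hlt
  · exact ⟨(F i).orderEmbOfFin rfl, ((F i).orderEmbOfFin rfl).strictMono, hτ i⟩

open Classical in
/-- A permutation that is not simple is an inflation of a shorter permutation by shorter
permutations: contract a nontrivial interval. -/
theorem exists_isInflation_of_not_isSimple {n : ℕ} {π : Equiv.Perm (Fin n)} (h : ¬ IsSimple π) :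
    ∃ (σ : FinPerm) (α : Fin σ.1 → FinPerm), IsInflation σ α ⟨n, π⟩ ∧ σ.1 < n ∧
      Contained σ ⟨n, π⟩ ∧ ∀ i, 0 < (α i).1 ∧ (α i).1 < n ∧ Contained (α i) ⟨n, π⟩ := by
  simp only [IsSimple, not_forall, not_or] at h
  obtain ⟨S, hS, hns, hnu⟩ := h
  rw [Set.not_subsingleton_iff] at hns
  obtain ⟨s₀, hs₀, s₁, hs₁, hne⟩ := hns
  obtain ⟨y, hy⟩ := (Set.ne_univ_iff_exists_notMem S).1 hnu
  let Q : Finset (Fin n) := Finset.univ.filter fun x => x ∈ S → x = s₀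
  have hQ : ∀ x, x ∈ Q ↔ (x ∈ S → x = s₀) := by simp [Q]
  let r : Fin n → Fin n := fun x => if x ∈ S then s₀ else x
  have hr : ∀ x, r x ∈ Q := by
    intro x
    rw [hQ]
    by_cases hx : x ∈ S <;> simp [r, hx]
  obtain ⟨τ, hτ⟩ := exists_pattern π (Q.orderEmbOfFin rfl) (Q.orderEmbOfFin rfl).injective
  let g : Fin n → Fin Q.card := fun x => (Q.orderIsoOfFin rfl).symm ⟨r x, hr x⟩
  have hg : ∀ x, Q.orderEmbOfFin rfl (g x) = r x := by
    intro x
    have : Q.orderIsoOfFin rfl (g x) = ⟨r x, hr x⟩ := OrderIso.apply_symm_apply _ _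
    exact congrArg Subtype.val this
  have hcard : Q.card < n := by
    have hlt : Q ⊂ Finset.univ := Finset.ssubset_univ_iff.2 fun h =>
      hne ((hQ s₁).1 (h ▸ Finset.mem_univ s₁) hs₁).symm
    simpa using Finset.card_lt_card hlt
  have hsurj : Function.Surjective g := by
    intro c
    refine ⟨Q.orderEmbOfFin rfl c, (Q.orderEmbOfFin rfl).injective ?_⟩
    rw [hg]
    have := (hQ _).1 (Q.orderEmbOfFin_mem rfl c)
    by_cases hc : Q.orderEmbOfFin rfl c ∈ S
    · rw [this hc]
      simp [r]
    · simp only [r, hc, if_false]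
  have hne_const : ∀ c, ∃ x, g x ≠ c := by
    intro c
    by_contra hall
    push Not at hall
    have : r s₀ = r y := by rw [← hg, ← hg, hall, hall]
    simp only [r, hs₀, hy, if_true, if_false] at this
    exact hy (this ▸ hs₀)
  have hpos : ∀ x z, g x < g z → x < z := by
    intro x z hxz
    have hlt : r x < r z := by
      rw [← hg x, ← hg z]
      exact (Q.orderEmbOfFin rfl).strictMono hxz
    by_cases hx : x ∈ S <;> by_cases hz : z ∈ S <;>
      simp only [r, hx, hz, if_true, if_false, lt_self_iff_false] at hlt
    · by_contra hle
      have hzx : z ≠ x := fun e => hz (e ▸ hx)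
      exact hz ((hS _ hs₀ _ hx z).1 hlt (lt_of_le_of_ne (not_lt.1 hle) hzx))
    · by_contra hle
      have hzx : z ≠ x := fun e => hx (e ▸ hz)
      exact hx ((hS _ hz _ hs₀ x).1 (lt_of_le_of_ne (not_lt.1 hle) hzx) hlt)
    · exact hlt
  have hval : ∀ x z, τ (g x) < τ (g z) → π x < π z := by
    intro x z hxz
    have hlt : π (r x) < π (r z) := by
      rw [← hg x, ← hg z]
      exact (hτ _ _).1 hxz
    by_cases hx : x ∈ S <;> by_cases hz : z ∈ S <;>
      simp only [r, hx, hz, if_true, if_false, lt_self_iff_false] at hlt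
    · by_contra hle
      have hzx : π z ≠ π x := fun e => hz (π.injective e ▸ hx)
      exact hz ((hS _ hs₀ _ hx z).2 hlt (lt_of_le_of_ne (not_lt.1 hle) hzx))
    · by_contra hle
      have hzx : π z ≠ π x := fun e => hx (π.injective e ▸ hz)
      exact hx ((hS _ hz _ hs₀ x).2 (lt_of_le_of_ne (not_lt.1 hle) hzx) hlt)
    · exact hlt
  obtain ⟨α, hα, hα'⟩ := exists_isInflation π ⟨Q.card, τ⟩ g hsurj hne_const hpos hval
  exact ⟨⟨Q.card, τ⟩, α, hα, hcard,
    ⟨Q.orderEmbOfFin rfl, (Q.orderEmbOfFin rfl).strictMono, hτ⟩, hα'⟩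

theorem isWreathClosed_wreathClosure (X : Set FinPerm) : IsWreathClosed (wreathClosure X) :=
  ⟨fun π hπ σ hσ C hC hX => hC.1 π (hπ C hC hX) σ hσ, fun σ α τ hσ hα hpos hinf C hC hX =>
    hC.2 σ α τ (hσ C hC hX) (fun i => hα i C hC hX) hpos hinf⟩

/-! ### The basis -/

set_option synthInstance.maxSize 1000 in
set_option synthInstance.maxHeartbeats 400000 in
/-- Every block of consecutive positions of a basis word is cut by an entry outside it. -/
theorem basisWords_simple : ∀ l ∈ basisWords, ∀ b < l.length, ∀ a < b,
    ¬ (a = 0 ∧ b + 1 = l.length) → ∃ c < l.length, (c < a ∨ b < c) ∧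
      (∃ i < l.length, (a ≤ i ∧ i ≤ b) ∧ l.getD i 0 < l.getD c 0) ∧
      ∃ j < l.length, (a ≤ j ∧ j ≤ b) ∧ l.getD c 0 < l.getD j 0 := by
  decide +kernel

theorem isSimple_of_mem_basisPerms {β : FinPerm} (hβ : β ∈ basisPerms) : IsSimple β.2 := by
  intro S hS
  by_cases hsub : S.Subsingleton
  · exact Or.inl hsub
  right
  have hne : S.Nonempty := (Set.not_subsingleton_iff.1 hsub).nonempty
  obtain ⟨a, haS, ha⟩ := Set.exists_min_image S id S.toFinite hne
  obtain ⟨b, hbS, hb⟩ := Set.exists_max_image S id S.toFinite hne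
  simp only [id] at ha hb
  have hab : a < b := by
    by_contra hle
    exact hsub fun x hx y hy => le_antisymm
      (((hb x hx).trans (not_lt.1 hle)).trans (ha y hy))
      (((hb y hy).trans (not_lt.1 hle)).trans (ha x hx))
  have hmem : ∀ x, a ≤ x → x ≤ b → x ∈ S := by
    intro x hax hxb
    rcases hax.eq_or_lt with rfl | hax
    · exact haS
    · rcases hxb.eq_or_lt with rfl | hxb
      · exact hbS
      · exact (hS a haS b hbS x).1 hax hxb
  by_cases hfull : (a : ℕ) = 0 ∧ (b : ℕ) + 1 = β.1
  · refine Set.eq_univ_of_forall fun x => hmem x ?_ ?_ <;> rw [Fin.le_def] <;> omega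
  · have hw := basisWords_simple _ hβ b (by rw [length_oneLine]; exact b.2) a hab
    rw [length_oneLine] at hw
    obtain ⟨c, hc, hcab, ⟨i, hi, ⟨hai, hib⟩, h₁⟩, j, hj, ⟨haj, hjb⟩, h₂⟩ := hw hfull
    rw [getD_oneLine β hi, getD_oneLine β hc] at h₁
    rw [getD_oneLine β hj, getD_oneLine β hc] at h₂
    have hcS := (hS _ (hmem ⟨i, hi⟩ hai hib) _ (hmem ⟨j, hj⟩ haj hjb) ⟨c, hc⟩).2
      (by rw [Fin.lt_def]; omega) (by rw [Fin.lt_def]; omega)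
    have h₃ := ha _ hcS
    have h₄ := hb _ hcS
    rw [Fin.le_def] at h₃ h₄
    simp only at h₃ h₄
    omega

theorem basisWords_length : ∀ l ∈ basisWords, l.length = 5 ∨ l.length = 6 := by decide +kernel

theorem basisWords_antichain : ∀ l ∈ basisWords, l.length = 5 → ∀ l' ∈ basisWords,
    l'.length = 6 → ∀ c : Fin 6, ∃ i j : Fin 5, ¬ (l.getD i 0 < l.getD j 0 ↔
      l'.getD (c.succAbove i) 0 < l'.getD (c.succAbove j) 0) := by
  decide +kernel

theorem isAntichain_basisPerms : IsAntichain Contained basisPerms := by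
  intro β hβ γ hγ hne hc
  have hlen := hc.length_le
  have h₁ := basisWords_length _ hβ
  have h₂ := basisWords_length _ hγ
  rw [length_oneLine] at h₁ h₂
  by_cases heq : β.1 = γ.1
  · exact hne (hc.eq_of_length_eq heq)
  have h5 : β.1 = 5 := by omega
  have h6 : γ.1 = 6 := by omega
  have hd := basisWords_antichain _ hβ (by rw [length_oneLine, h5]) _ hγ
    (by rw [length_oneLine, h6])
  obtain ⟨n, β⟩ := β
  obtain ⟨m, γ⟩ := γ
  obtain rfl : n = 5 := h5
  obtain rfl : m = 6 := h6
  obtain ⟨f, hf, hf'⟩ := hc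
  -- A strictly increasing map `Fin 5 → Fin 6` omits exactly one value.
  obtain ⟨c, hc⟩ : ∃ c : Fin 6, ∀ i, f i ≠ c := by
    by_contra hall
    push Not at hall
    have := Fintype.card_le_of_surjective f hall
    simp at this
  have hfc : f = c.succAbove := by
    have hsub : Set.range f ⊆ Set.range c.succAbove := by
      rintro _ ⟨i, rfl⟩
      rw [Fin.range_succAbove]
      exact hc i
    refine (StrictMono.range_inj hf (Fin.strictMono_succAbove c)).1
      (Set.eq_of_subset_of_ncard_le hsub ?_)
    rw [← Set.image_univ, ← Set.image_univ, Set.ncard_image_of_injective _ hf.injective,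
      Set.ncard_image_of_injective _ (Fin.strictMono_succAbove c).injective]
  subst hfc
  obtain ⟨i, j, hij⟩ := hd c
  apply hij
  rw [getD_oneLine _ i.2, getD_oneLine _ j.2, getD_oneLine _ (c.succAbove i).2,
    getD_oneLine _ (c.succAbove j).2]
  have h := hf' i j
  rw [Fin.lt_def, Fin.lt_def] at h
  exact Nat.succ_lt_succ_iff.trans (h.trans Nat.succ_lt_succ_iff.symm)

theorem Av_basisPerms_subset : Av basisPerms ⊆ wreathClosure oscillationClass := by
  intro π hπ
  have hosc : ∀ {π : FinPerm}, IsOscillation π → π ∈ wreathClosure oscillationClass :=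
    fun {π} h C _ hX => hX ⟨π, h, Contained.refl π⟩
  induction hk : π.1 using Nat.strong_induction_on generalizing π with
  | _ k ih =>
    subst hk
    by_cases hn : π.1 ≤ 2
    · exact hosc (isOscillation_of_length_le_two hn)
    by_cases hs : IsSimple π.2
    · exact hosc (isOscillation_of_isSimple hπ hs (by omega))
    obtain ⟨σ, α, hinf, hσ, hσc, hα⟩ := exists_isInflation_of_not_isSimple hs
    have hdown : ∀ τ : FinPerm, Contained τ π → τ ∈ Av basisPerms :=
      fun τ hτ β hβ hc => hπ β hβ (hc.trans hτ)
    exact (isWreathClosed_wreathClosure _).2 σ α π (ih _ hσ (hdown σ hσc) rfl)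
      (fun i => ih _ (hα i).2.1 (hdown _ (hα i).2.2) rfl) (fun i => (hα i).1) hinf

theorem isBasis_basisPerms : IsBasis basisPerms (wreathClosure oscillationClass) :=
  ⟨isAntichain_basisPerms, Set.Subset.antisymm
    (fun _ hπ => hπ _ (isWreathClosed_Av fun _ => isSimple_of_mem_basisPerms)
      oscillationClass_subset_Av) Av_basisPerms_subset⟩

end FinPerm

theorem mainTheorem7 (B : Set FinPerm) :
    FinPerm.IsBasis B (FinPerm.wreathClosure FinPerm.oscillationClass) ↔
      B = {π : FinPerm | ∃ β : FinPerm,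
        FinPerm.oneLine β ∈
          ({[2, 5, 3, 1, 4], [4, 1, 3, 5, 2], [2, 4, 6, 1, 5, 3], [2, 5, 1, 3, 6, 4],
            [3, 1, 4, 6, 2, 5], [3, 5, 1, 6, 2, 4], [4, 1, 5, 2, 6, 3]} : Set (List ℕ)) ∧
        π ∈ FinPerm.symmetries β} := by
  rw [FinPerm.basisPerms_eq]
  exact ⟨fun h => h.unique FinPerm.isBasis_basisPerms, fun h => h ▸ FinPerm.isBasis_basisPerms⟩
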